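/- Let $m\ge 2$ be an integer and let $c_1,c_2:\mathbb{R}\to\mathbb{R}$ be smooth ($C^\infty$) functions with $c_1(t)<c_2(t)$ for all $t\in\mathbb{R}$. Put $D=\{(x_1,x_2)\in\mathbb{R}^2 : c_1(x_2)<x_1<c_2(x_2)\}$ and let $$X=\Bigl\{(x_1,x_2,y_1,\dots,y_{m-1})\in\overline{D}\times\mathbb{R}^{m-1} : (x_1-c_1(x_2))(c_2(x_2)-x_1)-\sum_{j=1}^{m-1}y_j^2=0\Bigr\}\subset\mathbb{R}^{m+1},$$ which is an $m$-dimensional smooth submanifold without boundary. Let $\pi:X\to\mathbb{R}$ be the restriction to $X$ of the projection $(x_1,x_2,y)\mapsto x_1$. A contour of $\pi$ is a connected component of a level set of $\pi$; it is called critical if it contains a critical point of $\pi$. The Reeb space $R_\pi$ is the set of all contours of $\pi$, with the quotient topology from $X$. Write $S(c_i)=\{t : c_i'(t)=0\}$. A graph with ends is a connected Hausdorff space $R$ with a set $V\subset R$ of vertices such that $R\setminus V$ is non-empty, every connected component (edge) of $R\setminus V$ is homeomorphic to $\mathbb{R}$ and has closure homeomorphic to $[-1,1]$ or to the ray $[0,\infty)$,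 and $R$ carries the weak topology with respect to the closures of its edges. It is a graph (without ends) if the closure of every edge is homeomorphic to $[-1,1]$. Isomorphisms are homeomorphisms mapping the vertex set onto the vertex set. Suppose that $c_1(S(c_1))\cup c_2(S(c_2))$ is a discrete and closed subset of $\mathbb{R}$, that at least one of $c_1,c_2$ has a critical point, and that, as $t\to-\infty$, either both $c_1(t)$ and $c_2(t)$ tend to $+\infty$ or both tend to $-\infty$, and likewise (independently) as $t\to+\infty$. Then $\pi$ is proper, and $R_\pi$, with the set of all critical contours as vertex set, is a graph with ends (the Reeb graph of $\pi$). Moreover, the Reeb graph is isomorphic to a graph (without ends) if and only if $S(c_1)\cup S(c_2)$ is unbounded both below and above. -/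

import Mathlib

open Set Filter Topology
open scoped ContDiff

namespace Reeb

/-! ### Reeb spaces -/

/-- The contour of `f` through `x`: the connected component of `x` in its level set. -/
def contour {X : Type*} [TopologicalSpace X] (f : X → ℝ) (x : X) : Set X :=
  connectedComponentIn (f ⁻¹' {f x}) x

/-- Two points are equivalent when they lie in the same contour of `f`. -/
def contourSetoid {X : Type*} [TopologicalSpace X] (f : X → ℝ) : Setoid X :=
  Setoid.ker (contour f)

/-- The Reeb space of `f`, which carries the quotient topology. -/
abbrev ReebSpace {X : Type*} [TopologicalSpace X] (f : X → ℝ) : Type _ :=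
  Quotient (contourSetoid f)

/-- The quotient map onto the Reeb space. -/
def quotientMap {X : Type*} [TopologicalSpace X] (f : X → ℝ) (x : X) : ReebSpace f :=
  Quotient.mk (contourSetoid f) x

/-! ### Graphs, with or without ends -/

/-- The edges (open `1`-cells) of a `1`-dimensional complex `R` with vertex set `V`: the connected
components of the complement of `V`. -/
def edges {R : Type*} [TopologicalSpace R] (V : Set R) : Set (Set R) :=
  {e | ∃ x ∈ Vᶜ, e = connectedComponentIn Vᶜ x}

/-- `R` is a graph with ends whose vertex set is `V`: a connected Hausdorff space with at least
one edge, in which every edge is an open `1`-cell whose closure is homeomorphic to the closed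
interval `[-1, 1]` or to the ray `[0, ∞)`, and which has the weak topology with respect to the
closures of its edges.

(It follows that `V` is closed and discrete, that edges are open, and that the closure of an edge
consists of the edge and one or two vertices.) -/
structure IsGraphWithEnds (R : Type*) [TopologicalSpace R] (V : Set R) : Prop where
  t2 : T2Space R
  connected : ConnectedSpace R
  exists_edge : (edges V).Nonempty
  edge_homeo : ∀ e ∈ edges V, Nonempty (e ≃ₜ ℝ)
  closure_edge : ∀ e ∈ edges V,
    Nonempty (closure e ≃ₜ Icc (-1 : ℝ) 1) ∨ Nonempty (closure e ≃ₜ Ici (0 : ℝ))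
  weak_topology : ∀ A : Set R, (∀ e ∈ edges V, IsClosed (A ∩ closure e)) → IsClosed A

/-- `R` is a graph (without ends) whose vertex set is `V`: the closure of every edge is
homeomorphic to `[-1, 1]`. -/
def IsGraph (R : Type*) [TopologicalSpace R] (V : Set R) : Prop :=
  IsGraphWithEnds R V ∧ ∀ e ∈ edges V, Nonempty (closure e ≃ₜ Icc (-1 : ℝ) 1)

/-- The graph with ends `(R, V)` is isomorphic to some graph (without ends), where isomorphisms
are the homeomorphisms that map the vertex set onto the vertex set. -/
def IsIsomorphicToGraph (R : Type) [TopologicalSpace R] (V : Set R) : Prop :=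
  ∃ (G : Type) (_ : TopologicalSpace G) (W : Set G),
    IsGraph G W ∧ ∃ h : R ≃ₜ G, h '' V = W

/-! ### Critical points -/

/-- The critical set `S(c)` of a smooth function `c : ℝ → ℝ`. -/
def criticalSet (c : ℝ → ℝ) : Set ℝ := {t | deriv c t = 0}

/-- `p` is a critical point of the restriction of the smooth function `f` to the submanifold `M`
(without boundary) of the ambient space `E`: the differential of `f` at `p` vanishes on all tangent
vectors of `M` at `p`, that is, on the velocities of smooth curves in `M` through `p`. -/
def IsCriticalPointOn {E : Type*} [NormedAddCommGroup E] [NormedSpace ℝ E]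
    (M : Set E) (f : E → ℝ) (p : E) : Prop :=
  p ∈ M ∧ ∀ (ε : ℝ) (γ : ℝ → E), 0 < ε → ContDiffOn ℝ ∞ γ (Ioo (-ε) ε) →
    (∀ t ∈ Ioo (-ε) ε, γ t ∈ M) → γ 0 = p → deriv (fun t => f (γ t)) 0 = 0

/-- The points of the Reeb space of `f` restricted to `M` that are critical contours, that is,
contours containing a critical point. -/
def criticalContours {E : Type*} [NormedAddCommGroup E] [NormedSpace ℝ E]
    (M : Set E) (f : E → ℝ) : Set (ReebSpace (M.domRestrict f)) :=
  {r | ∃ x : M, IsCriticalPointOn M f x ∧ quotientMap (M.domRestrict f) x = r}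

/-! ### The manifold over the region between two graphs -/

/-- The open region between the graphs of `c₁` and `c₂`; the graphs are taken over the second
coordinate axis. -/
def region (c₁ c₂ : ℝ → ℝ) : Set (ℝ × ℝ) := {x | c₁ x.2 < x.1 ∧ x.1 < c₂ x.2}

/-- The space `ℝ^{m+1} = ℝ² × ℝ^{m-1}` (for `1 ≤ m`). -/
abbrev Ambient (m : ℕ) : Type := (ℝ × ℝ) × EuclideanSpace ℝ (Fin (m - 1))

/-- The manifold `X_{m, c₁, c₂}`, as a subset of `ℝ^{m+1}`. -/
def manifoldX (m : ℕ) (c₁ c₂ : ℝ → ℝ) : Set (Ambient m) :=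
  {p | p.1 ∈ closure (region c₁ c₂) ∧
    (p.1.1 - c₁ p.1.2) * (c₂ p.1.2 - p.1.1) - ∑ j, (p.2 j) ^ 2 = 0}

/-- The projection of `ℝ^{m+1}` to its first coordinate. -/
def proj (m : ℕ) (p : Ambient m) : ℝ := p.1.1

end Reeb

/-
The fibre of the manifold over a point of the closed strip between the two graphs is a sphere, whose
radius vanishes exactly on the boundary of the strip. The components of the slices of the strip at
constant first coordinate are compact intervals with end points on the boundary, so contours
correspond to these components, and the Reeb space is a quotient of the strip on which the first
coordinate is a proper height function with finite fibres. Away from the critical contours, which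
are those through points of the boundary where `cᵢ' = 0`, the height is a local homeomorphism to
`ℝ`. Such a height is injective on the closure of each edge, so that the Reeb space is a graph with
ends, and an edge has a compact closure if and only if the height is bounded on it.

If `S(c₁) ∪ S(c₂)` is bounded on one side, the contours through the boundary far out on that side
form an unbounded connected set without vertices. If it is unbounded on both sides, then the
contours that make up an edge lie between two segments of the strip at constant second coordinate,
over critical points of `c₁` or `c₂`, so that the height is bounded on the edge.
-/

namespace Reeb

/-! ### The real line -/

section RealLine

variable {J : Set ℝ}

theorem eq_Ioo_or_Ioi_or_Iio_or_univ (ho : IsOpen J) (hc : IsPreconnected J) (hn : J.Nonempty) :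
    (∃ a b, a < b ∧ J = Ioo a b) ∨ (∃ a, J = Ioi a) ∨ (∃ b, J = Iio b) ∨ J = univ := by
  have of_eq_Ioo : ∀ a b, J = Ioo a b → ∃ a b, a < b ∧ J = Ioo a b := fun a b h =>
    ⟨a, b, nonempty_Ioo.1 (h ▸ hn), h⟩
  have hi := ho.interior_eq
  rcases hc.mem_intervals with h | h | h | h | h | h | h | h | h | h
  · exact .inl (of_eq_Ioo _ _ (by rw [← interior_Icc, ← h, hi]))
  · exact .inl (of_eq_Ioo _ _ (by rw [← interior_Ico, ← h, hi]))
  · exact .inl (of_eq_Ioo _ _ (by rw [← interior_Ioc, ← h, hi]))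
  · exact .inl (of_eq_Ioo _ _ h)
  · exact .inr (.inl ⟨sInf J, by rw [← interior_Ici, ← h, hi]⟩)
  · exact .inr (.inl ⟨_, h⟩)
  · exact .inr (.inr (.inl ⟨sSup J, by rw [← interior_Iic, ← h, hi]⟩))
  · exact .inr (.inr (.inl ⟨_, h⟩))
  · exact .inr (.inr (.inr h))
  · exact absurd h hn.ne_empty

theorem nonempty_homeomorph_Ioo {a b : ℝ} (h : a < b) : Nonempty (Ioo a b ≃ₜ ℝ) := by
  have e := (OpenPartialHomeomorph.univBall ((a + b) / 2) ((b - a) / 2)).toHomeomorphSourceTarget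
  rw [OpenPartialHomeomorph.univBall_source,
    OpenPartialHomeomorph.univBall_target _ (by linarith), ← Real.Ioo_eq_ball] at e
  exact ⟨e.symm.trans (Homeomorph.Set.univ ℝ)⟩

theorem nonempty_homeomorph_Ioi (a : ℝ) : Nonempty (Ioi a ≃ₜ ℝ) :=
  ⟨((Homeomorph.subRight a).sets (by ext x; simp) : Ioi a ≃ₜ Ioi (0 : ℝ)).trans
    Real.expOrderIso.symm.toHomeomorph⟩

theorem nonempty_homeomorph_real (ho : IsOpen J) (hc : IsPreconnected J) (hn : J.Nonempty) :
    Nonempty (J ≃ₜ ℝ) := by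
  rcases eq_Ioo_or_Ioi_or_Iio_or_univ ho hc hn with ⟨a, b, hab, rfl⟩ | ⟨a, rfl⟩ | ⟨b, rfl⟩ | rfl
  · exact nonempty_homeomorph_Ioo hab
  · exact nonempty_homeomorph_Ioi a
  · obtain ⟨e⟩ := nonempty_homeomorph_Ioi (-b)
    exact ⟨((Homeomorph.neg ℝ).sets (by ext x; simp) : Iio b ≃ₜ Ioi (-b)).trans e⟩
  · exact ⟨Homeomorph.Set.univ ℝ⟩

theorem nonempty_homeomorph_closure_of_isBounded (ho : IsOpen J) (hc : IsPreconnected J)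
    (hn : J.Nonempty) (hb : Bornology.IsBounded J) :
    Nonempty (closure J ≃ₜ Icc (-1 : ℝ) 1) := by
  rcases eq_Ioo_or_Ioi_or_Iio_or_univ ho hc hn with ⟨a, b, hab, rfl⟩ | ⟨a, rfl⟩ | ⟨b, rfl⟩ | rfl
  · rw [closure_Ioo hab.ne]
    exact ⟨(iccHomeoI a b hab).trans (iccHomeoI (-1 : ℝ) 1 (by norm_num)).symm⟩
  · exact absurd hb.bddAbove (not_bddAbove_Ioi a)
  · exact absurd hb.bddBelow (not_bddBelow_Iio b)
  · exact absurd hb.bddAbove not_bddAbove_univ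

theorem nonempty_homeomorph_closure (ho : IsOpen J) (hc : IsPreconnected J)
    (hn : J.Nonempty) (hu : J ≠ univ) :
    Nonempty (closure J ≃ₜ Icc (-1 : ℝ) 1) ∨ Nonempty (closure J ≃ₜ Ici (0 : ℝ)) := by
  rcases eq_Ioo_or_Ioi_or_Iio_or_univ ho hc hn with ⟨a, b, -, rfl⟩ | ⟨a, rfl⟩ | ⟨b, rfl⟩ | rfl
  · exact .inl (nonempty_homeomorph_closure_of_isBounded ho hc hn (Metric.isBounded_Ioo a b))
  · rw [closure_Ioi]
    exact .inr ⟨(Homeomorph.subRight a).sets (by ext x; simp)⟩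
  · rw [closure_Iio]
    exact .inr ⟨(Homeomorph.subLeft b).sets (by ext x; simp)⟩
  · exact absurd rfl hu

theorem finite_frontier (ho : IsOpen J) (hc : IsPreconnected J) : (frontier J).Finite := by
  rcases J.eq_empty_or_nonempty with rfl | hn
  · simp
  rcases eq_Ioo_or_Ioi_or_Iio_or_univ ho hc hn with ⟨a, b, hab, rfl⟩ | ⟨a, rfl⟩ | ⟨b, rfl⟩ | rfl
  · simp [frontier_Ioo hab]
  · simp
  · simp
  · simp

theorem subset_Ioo_of_notMem (hJ : J.OrdConnected) {a t b : ℝ} (ht : t ∈ J) (hat : a < t)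
    (htb : t < b) (ha : a ∉ J) (hb : b ∉ J) : J ⊆ Ioo a b := fun _ hs =>
  ⟨lt_of_not_ge fun h => ha (hJ.out hs ht ⟨h, hat.le⟩),
    lt_of_not_ge fun h => hb (hJ.out ht hs ⟨htb.le, h⟩)⟩

variable {K : Set ℝ} {t : ℝ}

theorem exists_connectedComponentIn_eq_Icc (hK : IsCompact K) (ht : t ∈ K) :
    ∃ α β, connectedComponentIn K t = Icc α β ∧
      (∃ᶠ p in 𝓝[<] α, p ∉ K) ∧ ∃ᶠ q in 𝓝[>] β, q ∉ K := by
  set C := connectedComponentIn K t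
  have htC : t ∈ C := mem_connectedComponentIn ht
  have hCK : C ⊆ K := connectedComponentIn_subset K t
  have hclosed : IsClosed C := isClosed_of_closure_subset <|
    isPreconnected_connectedComponentIn.closure.subset_connectedComponentIn (subset_closure htC)
      (closure_minimal hCK hK.isClosed)
  have hCeq : C = Icc (sInf C) (sSup C) := eq_Icc_of_connected_compact
    (isConnected_connectedComponentIn_iff.2 ht) (hK.of_isClosed_subset hclosed hCK)
  have hmax : ∀ a b, t ∈ Icc a b → Icc a b ⊆ K → Icc a b ⊆ C := fun a b h =>
    isPreconnected_Icc.subset_connectedComponentIn h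
  generalize sInf C = α at hCeq ⊢
  generalize sSup C = β at hCeq ⊢
  obtain ⟨hαt, htβ⟩ : t ∈ Icc α β := hCeq ▸ htC
  rw [hCeq] at hCK hmax
  refine ⟨α, β, hCeq, fun h => ?_, fun h => ?_⟩
  · obtain ⟨l, hl : l < α, hlK⟩ := mem_nhdsLT_iff_exists_Ico_subset.1 h
    have hsub : Icc l β ⊆ K := fun s hs => (lt_or_ge s α).elim
      (fun hsα => not_not.1 (hlK ⟨hs.1, hsα⟩)) fun hαs => hCK ⟨hαs, hs.2⟩
    exact hl.not_ge (hmax l β ⟨hl.le.trans hαt, htβ⟩ hsub ⟨le_rfl, by linarith⟩).1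
  · obtain ⟨r, hr : β < r, hrK⟩ := mem_nhdsGT_iff_exists_Ioc_subset.1 h
    have hsub : Icc α r ⊆ K := fun s hs => (le_or_gt s β).elim
      (fun hsβ => hCK ⟨hs.1, hsβ⟩) fun hβs => not_not.1 (hrK ⟨hβs, hs.2⟩)
    exact hr.not_ge (hmax α r ⟨hαt, htβ.trans hr.le⟩ hsub ⟨by linarith, le_rfl⟩).2

theorem exists_Icc_subset_of_isCompact (hK : IsCompact K) (ht : t ∈ K) {O : Set ℝ} (hO : IsOpen O)
    (hKO : K ⊆ O) : ∃ p q, p < t ∧ t < q ∧ p ∉ K ∧ q ∉ K ∧ Icc p q ⊆ O := by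
  obtain ⟨α, β, hC, hα, hβ⟩ := exists_connectedComponentIn_eq_Icc hK ht
  have hsub : Icc α β ⊆ O := hC ▸ (connectedComponentIn_subset K t).trans hKO
  obtain ⟨hαt, htβ⟩ : t ∈ Icc α β := hC ▸ mem_connectedComponentIn ht
  have hαβ : α ≤ β := hαt.trans htβ
  obtain ⟨l, hl, hlO⟩ := exists_Ioc_subset_of_mem_nhds (hO.mem_nhds (hsub ⟨le_rfl, hαβ⟩))
    (exists_lt α)
  obtain ⟨r, hr, hrO⟩ := exists_Ico_subset_of_mem_nhds (hO.mem_nhds (hsub ⟨hαβ, le_rfl⟩))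
    (exists_gt β)
  obtain ⟨p, hpK, hlp, hpα⟩ := (hα.and_eventually (Ioo_mem_nhdsLT hl)).exists
  obtain ⟨q, hqK, hβq, hqr⟩ := (hβ.and_eventually (Ioo_mem_nhdsGT hr)).exists
  refine ⟨p, q, hpα.trans_le hαt, htβ.trans_lt hβq, hpK, hqK, fun s ⟨hps, hsq⟩ => ?_⟩
  rcases le_total s α with hsα | hαs
  · exact hlO ⟨hlp.trans_le hps, hsα⟩
  rcases le_total s β with hsβ | hβs
  · exact hsub ⟨hαs, hsβ⟩
  · exact hrO ⟨hβs, hsq.trans_lt hqr⟩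

end RealLine

theorem not_bddAbove_iff_frequently_atTop {α : Type*} [LinearOrder α] [Nonempty α] [NoMaxOrder α]
    {s : Set α} : ¬ BddAbove s ↔ ∃ᶠ x in atTop, x ∈ s := by
  simp only [not_bddAbove_iff, frequently_atTop', and_comm]

theorem not_bddBelow_iff_frequently_atBot {α : Type*} [LinearOrder α] [Nonempty α] [NoMinOrder α]
    {s : Set α} : ¬ BddBelow s ↔ ∃ᶠ x in atBot, x ∈ s := by
  simp only [not_bddBelow_iff, frequently_atBot', and_comm]

/-! ### Discrete sets and local homeomorphisms -/

theorem eventually_eq_of_mem_of_isDiscrete {X : Type*} [TopologicalSpace X] {S : Set X}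
    (hc : IsClosed S) (hd : IsDiscrete S) (a : X) : ∀ᶠ y in 𝓝 a, y ∈ S → y = a := by
  have ha := disjoint_principal_right.1 (isClosed_and_discrete_iff.1 ⟨hc, hd⟩ a)
  filter_upwards [eventually_nhdsWithin_iff.1 ha] with y hy hyS
  exact by_contra fun hya => hy hya hyS

section LocalHomeomorph

variable {X Y : Type*} [TopologicalSpace X] [TopologicalSpace Y] {f : X → Y}

theorem isLocalHomeomorphOn_of_eventually_inverse {s : Set X} (hf : Continuous f)
    (hs : ∀ x ∈ s, ∃ g : Y → X, Continuous g ∧ (∀ᶠ x' in 𝓝 x, g (f x') = x') ∧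
      ∀ᶠ y in 𝓝 (f x), f (g y) = y) : IsLocalHomeomorphOn f s := by
  refine .mk f s fun x hx => ?_
  obtain ⟨g, hg, hgf, hfg⟩ := hs x hx
  obtain ⟨U, hU, hUo, hxU⟩ := eventually_nhds_iff.1 hgf
  obtain ⟨W, hW, hWo, hxW⟩ := eventually_nhds_iff.1 hfg
  refine ⟨{ toFun := f
            invFun := g
            source := U ∩ f ⁻¹' W
            target := W ∩ g ⁻¹' U
            map_source' := fun y hy => ⟨hy.2, by rw [mem_preimage, hU y hy.1]; exact hy.1⟩
            map_target' := fun y hy => ⟨hy.2, by rw [mem_preimage, hW y hy.1]; exact hy.1⟩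
            left_inv' := fun y hy => hU y hy.1
            right_inv' := fun y hy => hW y hy.1
            open_source := hUo.inter (hWo.preimage hf)
            open_target := hWo.inter (hUo.preimage hg)
            continuousOn_toFun := hf.continuousOn
            continuousOn_invFun := hg.continuousOn }, ⟨hxU, hxW⟩, fun _ _ => rfl⟩

theorem exists_isOpen_isPreconnected_injOn [LocallyConnectedSpace Y] {s N : Set X} {x : X}
    (hf : IsLocalHomeomorphOn f s) (hx : x ∈ s) (hN : N ∈ 𝓝 x) :
    ∃ W ⊆ N, IsOpen W ∧ IsPreconnected W ∧ x ∈ W ∧ InjOn f W := by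
  obtain ⟨e, hxe, rfl⟩ := hf x hx
  set U := e.source ∩ interior N
  have hUo : IsOpen (e '' U) :=
    e.isOpen_image_of_subset_source (e.open_source.inter isOpen_interior) inter_subset_left
  have hxU : x ∈ U := ⟨hxe, mem_interior_iff_mem_nhds.2 hN⟩
  set C := connectedComponentIn (e '' U) (e x)
  have hCU : C ⊆ e '' U := connectedComponentIn_subset _ _
  have hCt : C ⊆ e.target := hCU.trans (image_subset_iff.2 fun y hy => e.map_source hy.1)
  have hsub : e.symm '' C ⊆ U := by
    rintro _ ⟨y, hy, rfl⟩
    obtain ⟨z, hz, rfl⟩ := hCU hy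
    rwa [e.left_inv hz.1]
  exact ⟨e.symm '' C, hsub.trans (inter_subset_right.trans interior_subset),
    e.isOpen_image_symm_of_subset_target hUo.connectedComponentIn hCt,
    isPreconnected_connectedComponentIn.image _ (e.continuousOn_symm.mono hCt),
    ⟨e x, mem_connectedComponentIn (mem_image_of_mem e hxU), e.left_inv hxe⟩,
    e.injOn.mono (hsub.trans inter_subset_left)⟩

end LocalHomeomorph

section LocalHomeomorphReal

variable {X : Type*} [TopologicalSpace X] [T2Space X] {f : X → ℝ}

theorem injOn_union_of_isLocalHomeomorph (hf : IsLocalHomeomorph f) {U U' : Set X}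
    (hU : IsOpen U) (hU' : IsOpen U') (hc : IsPreconnected U) (hc' : IsPreconnected U')
    (hi : InjOn f U) (hi' : InjOn f U') (hm : (U ∩ U').Nonempty) : InjOn f (U ∪ U') := by
  have : Nonempty X := hm.to_type
  obtain ⟨z, hz, hz'⟩ := hm
  have continuousOn_inv : ∀ {W : Set X}, IsOpen W → InjOn f W →
      ContinuousOn (Function.invFunOn f W) (f '' W) := fun hW hinj =>
    (hf.isOpenMap.domRestrict hW).continuousOn_image_of_leftInvOn hinj.leftInvOn_invFunOn
  have hJ : IsPreconnected (f '' U ∩ f '' U') :=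
    ((hc.image f hf.continuous.continuousOn).ordConnected.inter
      (hc'.image f hf.continuous.continuousOn).ordConnected).isPreconnected
  have heq : EqOn (Function.invFunOn f U) (Function.invFunOn f U') (f '' U ∩ f '' U') := by
    refine (T2Space.isSeparatedMap f).eqOn_of_comp_eqOn hf.isLocallyInjective hJ
      ((continuousOn_inv hU hi).mono inter_subset_left)
      ((continuousOn_inv hU' hi').mono inter_subset_right) (fun y hy => ?_)
      (a := f z) ⟨mem_image_of_mem f hz, mem_image_of_mem f hz'⟩ ?_
    · exact (Function.invFunOn_eq hy.1).trans (Function.invFunOn_eq hy.2).symm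
    · rw [hi.leftInvOn_invFunOn hz, hi'.leftInvOn_invFunOn hz']
  have cross : ∀ x ∈ U, ∀ y ∈ U', f x = f y → x = y := fun x hx y hy hxy => by
    rw [← hi.leftInvOn_invFunOn hx, ← hi'.leftInvOn_invFunOn hy, ← hxy]
    exact heq ⟨mem_image_of_mem f hx, y, hy, hxy.symm⟩
  rintro x (hx | hx) y (hy | hy) hxy
  · exact hi hx hy hxy
  · exact cross x hx y hy hxy
  · exact (cross y hy x hx hxy.symm).symm
  · exact hi' hx hy hxy

theorem injective_of_isLocalHomeomorph [PreconnectedSpace X] (hf : IsLocalHomeomorph f) :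
    Function.Injective f := by
  let Joined (x y : X) : Prop :=
    ∃ W, IsOpen W ∧ IsPreconnected W ∧ InjOn f W ∧ x ∈ W ∧ y ∈ W
  suffices h : ∀ x y, Joined x y by
    intro x y hxy
    obtain ⟨W, -, -, hi, hx, hy⟩ := h x y
    exact hi hx hy hxy
  intro x y
  refine isPreconnected_univ.induction₂' Joined (fun x _ => ?_) ?_ (mem_univ x) (mem_univ y)
  · obtain ⟨W, -, hW, hWc, hxW, hWi⟩ :=
      exists_isOpen_isPreconnected_injOn hf.isLocalHomeomorphOn (mem_univ x) univ_mem
    filter_upwards [nhdsWithin_le_nhds (hW.mem_nhds hxW)] with y hy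
    exact ⟨⟨W, hW, hWc, hWi, hxW, hy⟩, ⟨W, hW, hWc, hWi, hy, hxW⟩⟩
  · rintro x y z - - - ⟨W, hW, hWc, hWi, hx, hy⟩ ⟨W', hW', hWc', hWi', hy', hz⟩
    exact ⟨W ∪ W', hW.union hW', hWc.union y hy hy' hWc',
      injOn_union_of_isLocalHomeomorph hf hW hW' hWc hWc' hWi hWi' ⟨y, hy, hy'⟩, .inl hx, .inr hz⟩

end LocalHomeomorphReal

theorem isConnected_preimage_of_isQuotientMap {X Y : Type*} [TopologicalSpace X]
    [TopologicalSpace Y] {f : X → Y} (hf : IsQuotientMap f)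
    (hfib : ∀ y, IsPreconnected (f ⁻¹' {y})) {s : Set Y} (ho : IsOpen s) (hs : IsConnected s) :
    IsConnected (f ⁻¹' s) := by
  have : ConnectedSpace s := isConnected_iff_connectedSpace.1 hs
  have hfib' : ∀ y, IsConnected (s.restrictPreimage f ⁻¹' {y}) := by
    intro y
    have himage : Subtype.val '' (s.restrictPreimage f ⁻¹' {y}) = f ⁻¹' {(y : Y)} := by
      ext x
      refine ⟨?_, fun hx => ⟨⟨x, show f x ∈ s from hx ▸ y.2⟩, Subtype.ext hx, rfl⟩⟩
      rintro ⟨x, hx, rfl⟩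
      exact congrArg Subtype.val hx
    refine ⟨(hf.restrictPreimage_isOpen ho).surjective y, ?_⟩
    rw [← IsInducing.subtypeVal.isPreconnected_image, himage]
    exact hfib y
  have huniv := (hf.restrictPreimage_isOpen ho).isCoinducing.isConnected_preimage_of_isClosed
    hfib' isClosed_univ isConnected_univ
  rw [preimage_univ] at huniv
  rw [← Subtype.range_coe (s := f ⁻¹' s), ← image_univ]
  exact huniv.image _ continuous_subtype_val.continuousOn

/-! ### Height functions -/

section Edges

variable {R : Type*} [TopologicalSpace R] {V e : Set R}

theorem subset_compl_of_mem_edges (he : e ∈ edges V) : e ⊆ Vᶜ := by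
  obtain ⟨r, -, rfl⟩ := he
  exact connectedComponentIn_subset _ _

theorem isConnected_of_mem_edges (he : e ∈ edges V) : IsConnected e := by
  obtain ⟨r, hr, rfl⟩ := he
  exact isConnected_connectedComponentIn_iff.2 hr

theorem eq_connectedComponentIn_of_mem_edges (he : e ∈ edges V) {s : R} (hs : s ∈ e) :
    e = connectedComponentIn Vᶜ s := by
  obtain ⟨r, -, rfl⟩ := he
  exact connectedComponentIn_eq hs

theorem subset_of_mem_edges (he : e ∈ edges V) {A : Set R} (hA : IsPreconnected A) (hAV : A ⊆ Vᶜ)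
    (hm : (A ∩ e).Nonempty) : A ⊆ e := by
  obtain ⟨s, hsA, hse⟩ := hm
  rw [eq_connectedComponentIn_of_mem_edges he hse]
  exact hA.subset_connectedComponentIn hsA hAV

theorem closure_inter_compl_subset_of_mem_edges (he : e ∈ edges V) : closure e ∩ Vᶜ ⊆ e :=
  subset_of_mem_edges he
    ((isConnected_of_mem_edges he).isPreconnected.subset_closure
      (subset_inter subset_closure (subset_compl_of_mem_edges he)) inter_subset_left)
    inter_subset_right
    ((isConnected_of_mem_edges he).nonempty.mono fun _ hx =>
      ⟨⟨subset_closure hx, subset_compl_of_mem_edges he hx⟩, hx⟩)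

end Edges

/-- `h` is a height function on `R` with vertex set `V`: it is proper with finite fibres, the
levels of the vertices form a closed discrete set, and `h` is a local homeomorphism away from `V`.
It exhibits `R` as a graph with ends, whose edges it embeds into the line. -/
structure IsHeight {R : Type*} [TopologicalSpace R] (V : Set R) (h : R → ℝ) : Prop where
  isProperMap : IsProperMap h
  finite_fiber : ∀ a, (h ⁻¹' {a}).Finite
  isClosed_image : IsClosed (h '' V)
  isDiscrete_image : IsDiscrete (h '' V)
  isLocalHomeomorphOn : IsLocalHomeomorphOn h Vᶜ

namespace IsHeight

variable {R : Type*} [TopologicalSpace R] {V e : Set R} {h : R → ℝ}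

theorem continuous (H : IsHeight V h) : Continuous h := H.isProperMap.continuous

theorem eventually_eq_of_mem_image (H : IsHeight V h) (a : ℝ) :
    ∀ᶠ y in 𝓝 a, y ∈ h '' V → y = a :=
  eventually_eq_of_mem_of_isDiscrete H.isClosed_image H.isDiscrete_image a

theorem isClosed_of_subset [T1Space R] (H : IsHeight V h) {A : Set R} (hA : A ⊆ V) :
    IsClosed A := by
  refine isOpen_compl_iff.1 (isOpen_iff_mem_nhds.2 fun r hr => ?_)
  have hfin : IsClosed (h ⁻¹' {h r} ∩ A) :=
    ((H.finite_fiber _).subset inter_subset_left).isClosed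
  filter_upwards [H.continuous.continuousAt.eventually (H.eventually_eq_of_mem_image (h r)),
    hfin.isOpen_compl.mem_nhds fun hrA => hr hrA.2] with x hx hxA hxA'
  exact hxA ⟨hx (mem_image_of_mem h (hA hxA')), hxA'⟩

theorem isOpen_edge [T1Space R] (H : IsHeight V h) (he : e ∈ edges V) : IsOpen e := by
  refine isOpen_iff_mem_nhds.2 fun r hr => ?_
  have hrV := subset_compl_of_mem_edges he hr
  obtain ⟨W, hWV, hW, hWc, hrW, -⟩ := exists_isOpen_isPreconnected_injOn H.isLocalHomeomorphOn hrV
    ((H.isClosed_of_subset Subset.rfl).isOpen_compl.mem_nhds hrV)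
  exact mem_of_superset (hW.mem_nhds hrW) (subset_of_mem_edges he hWc hWV ⟨r, hrW, hr⟩)

theorem isOpenEmbedding_edge [T2Space R] (H : IsHeight V h) (he : e ∈ edges V) :
    IsOpenEmbedding (e.domRestrict h) := by
  have hc : PreconnectedSpace e :=
    isPreconnected_iff_preconnectedSpace.1 (isConnected_of_mem_edges he).isPreconnected
  have hval : IsLocalHomeomorph ((↑) : e → R) :=
    (H.isOpen_edge he).isOpenEmbedding_subtypeVal.isLocalHomeomorph
  have hloc : IsLocalHomeomorph (e.domRestrict h) :=
    isLocalHomeomorph_iff_isLocalHomeomorphOn_univ.2 (H.isLocalHomeomorphOn.comp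
      hval.isLocalHomeomorphOn fun x _ => subset_compl_of_mem_edges he x.2)
  exact hloc.isOpenEmbedding_of_injective (injective_of_isLocalHomeomorph hloc)

theorem isOpen_image_edge [T2Space R] (H : IsHeight V h) (he : e ∈ edges V) :
    IsOpen (h '' e) := by
  rw [← range_domRestrict]
  exact (H.isOpenEmbedding_edge he).isOpen_range

theorem isConnected_image_edge (H : IsHeight V h) (he : e ∈ edges V) : IsConnected (h '' e) :=
  (isConnected_of_mem_edges he).image h H.continuous.continuousOn

theorem nonempty_homeomorph_edge [T2Space R] (H : IsHeight V h) (he : e ∈ edges V) :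
    Nonempty (e ≃ₜ ℝ) := by
  obtain ⟨φ⟩ := nonempty_homeomorph_real (H.isOpen_image_edge he)
    (H.isConnected_image_edge he).isPreconnected (H.isConnected_image_edge he).nonempty
  exact ⟨((H.isOpenEmbedding_edge he).isEmbedding.toHomeomorph.trans
    (Homeomorph.setCongr (range_domRestrict h e))).trans φ⟩

theorem isPreconnected_edge_inter_preimage [T2Space R] (H : IsHeight V h) (he : e ∈ edges V)
    {Q : Set ℝ} (hQ : Q.OrdConnected) : IsPreconnected (e ∩ h ⁻¹' Q) := by
  have hQe : IsPreconnected (h '' e ∩ Q) :=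
    ((H.isConnected_image_edge he).isPreconnected.ordConnected.inter hQ).isPreconnected
  have hemb := H.isOpenEmbedding_edge he
  convert (hQe.preimage_of_isOpenMap hemb.injective hemb.isOpenMap
    (by rw [range_domRestrict]; exact inter_subset_left)).image
    Subtype.val continuous_subtype_val.continuousOn using 1
  ext x
  constructor
  · rintro ⟨hx, hxQ⟩
    exact ⟨⟨x, hx⟩, ⟨mem_image_of_mem h hx, hxQ⟩, rfl⟩
  · rintro ⟨⟨y, hy⟩, hyQ, rfl⟩
    exact ⟨hy, hyQ.2⟩

theorem injOn_closure_edge [T2Space R] (H : IsHeight V h) (he : e ∈ edges V) :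
    InjOn h (closure e) := by
  intro z hz w hw hzw
  by_contra hne
  obtain ⟨O, O', hO, hO', hzO, hfO', hd⟩ : SeparatedNhds {z} (h ⁻¹' {h z} \ {z}) :=
    .of_isCompact_isCompact isCompact_singleton
      ((H.finite_fiber _).subset sdiff_subset).isCompact disjoint_sdiff_right
  have hwO' : w ∈ O' := hfO' ⟨hzw.symm, Ne.symm hne⟩
  have hev : ∀ᶠ y in 𝓝 (h z), ∀ x ∈ h ⁻¹' {y}, x ∈ O ∪ O' := by
    refine H.isProperMap.isClosedMap.eventually_nhds_fiber (h z) fun x hx => ?_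
    by_cases hxz : x = z
    · exact (hO.union hO').mem_nhds (.inl (hxz ▸ hzO rfl))
    · exact (hO.union hO').mem_nhds (.inr (hfO' ⟨hx, hxz⟩))
  obtain ⟨ε, hε, hball⟩ := Metric.eventually_nhds_iff_ball.1 hev
  set Q := Metric.ball (h z) ε
  have hzQ : h z ∈ Q := Metric.mem_ball_self hε
  have hQ : IsOpen (h ⁻¹' Q) := Metric.isOpen_ball.preimage H.continuous
  have hconn : IsPreconnected (e ∩ h ⁻¹' Q) :=
    H.isPreconnected_edge_inter_preimage he (convex_ball _ _).ordConnected
  obtain ⟨x, ⟨hxO, hxQ⟩, hxe⟩ := mem_closure_iff.1 hz _ (hO.inter hQ) ⟨hzO rfl, hzQ⟩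
  obtain ⟨y, ⟨hyO', hyQ⟩, hye⟩ := mem_closure_iff.1 hw _ (hO'.inter hQ)
    ⟨hwO', show h w ∈ Q from hzw ▸ hzQ⟩
  have heO : e ∩ h ⁻¹' Q ⊆ O := hconn.subset_left_of_subset_union hO hO' hd
    (fun u hu => hball (h u) hu.2 u rfl) ⟨x, ⟨hxe, hxQ⟩, hxO⟩
  exact disjoint_left.1 hd (heO ⟨hye, hyQ⟩) hyO'

theorem closure_image (H : IsHeight V h) (A : Set R) : closure (h '' A) = h '' closure A :=
  H.isProperMap.isClosedMap.closure_image_eq_of_continuous H.continuous A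

theorem nonempty_homeomorph_closure_edge [T2Space R] (H : IsHeight V h) (he : e ∈ edges V) :
    Nonempty (closure e ≃ₜ closure (h '' e)) := by
  have hemb : IsClosedEmbedding ((closure e).domRestrict h) :=
    .of_continuous_injective_isClosedMap (H.continuous.comp continuous_subtype_val)
      (injOn_iff_injective.1 (H.injOn_closure_edge he))
      (H.isProperMap.isClosedMap.comp isClosed_closure.isClosedMap_subtype_val)
  exact ⟨hemb.isEmbedding.toHomeomorph.trans (Homeomorph.setCongr
    ((range_domRestrict h _).trans (H.closure_image e).symm))⟩

theorem nonempty_homeomorph_Icc_iff [T2Space R] (H : IsHeight V h) (he : e ∈ edges V) :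
    Nonempty (closure e ≃ₜ Icc (-1 : ℝ) 1) ↔ Bornology.IsBounded (h '' e) := by
  obtain ⟨ψ⟩ := H.nonempty_homeomorph_closure_edge he
  constructor
  · rintro ⟨φ⟩
    have : CompactSpace (closure (h '' e)) := (φ.symm.trans ψ).compactSpace
    exact (isCompact_iff_compactSpace.2 this).isBounded.subset subset_closure
  · intro hb
    obtain ⟨φ⟩ := nonempty_homeomorph_closure_of_isBounded (H.isOpen_image_edge he)
      (H.isConnected_image_edge he).isPreconnected (H.isConnected_image_edge he).nonempty hb
    exact ⟨ψ.trans φ⟩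

theorem image_edge_ne_univ [T2Space R] [PreconnectedSpace R] (H : IsHeight V h)
    (hV : V.Nonempty) (he : e ∈ edges V) : h '' e ≠ univ := by
  intro hu
  have hclosed : IsClosed e := isClosed_of_closure_subset fun x hx => by
    obtain ⟨y, hy, hyx⟩ : h x ∈ h '' e := hu ▸ mem_univ _
    rwa [← H.injOn_closure_edge he (subset_closure hy) hx hyx]
  have heq := IsClopen.eq_univ ⟨hclosed, H.isOpen_edge he⟩ (isConnected_of_mem_edges he).nonempty
  obtain ⟨v, hv⟩ := hV
  exact subset_compl_of_mem_edges he (heq ▸ mem_univ v) hv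

theorem nonempty_homeomorph_Icc_or_Ici [T2Space R] [PreconnectedSpace R] (H : IsHeight V h)
    (hV : V.Nonempty) (he : e ∈ edges V) :
    Nonempty (closure e ≃ₜ Icc (-1 : ℝ) 1) ∨ Nonempty (closure e ≃ₜ Ici (0 : ℝ)) := by
  obtain ⟨ψ⟩ := H.nonempty_homeomorph_closure_edge he
  exact (nonempty_homeomorph_closure (H.isOpen_image_edge he)
    (H.isConnected_image_edge he).isPreconnected (H.isConnected_image_edge he).nonempty
    (H.image_edge_ne_univ hV he)).imp (fun ⟨φ⟩ => ⟨ψ.trans φ⟩) (fun ⟨φ⟩ => ⟨ψ.trans φ⟩)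

theorem subset_image_edge [T2Space R] (H : IsHeight V h) (he : e ∈ edges V) {Q : Set ℝ}
    (hQ : IsPreconnected Q) (hQV : Disjoint Q (h '' V)) (hm : (Q ∩ h '' e).Nonempty) :
    Q ⊆ h '' e := by
  refine hQ.subset_of_closure_inter_subset (H.isOpen_image_edge he) hm ?_
  rw [H.closure_image]
  rintro _ ⟨⟨z, hz, rfl⟩, hzQ⟩
  have hzV : z ∉ V := fun hzV => disjoint_left.1 hQV hzQ (mem_image_of_mem h hzV)
  exact mem_image_of_mem h (closure_inter_compl_subset_of_mem_edges he ⟨hz, hzV⟩)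

theorem exists_finite_meets_edges [T2Space R] (H : IsHeight V h) (a : ℝ) :
    ∃ N ∈ 𝓝 a, ∃ F : Set R, F.Finite ∧
      ∀ e ∈ edges V, (e ∩ h ⁻¹' N).Nonempty → (e ∩ F).Nonempty := by
  obtain ⟨δ, hδ, hiso⟩ := Metric.eventually_nhds_iff_ball.1 (H.eventually_eq_of_mem_image a)
  rw [Real.ball_eq_Ioo] at hiso
  refine ⟨Ioo (a - δ) (a + δ), Ioo_mem_nhds (by linarith) (by linarith),
    h ⁻¹' {a - δ / 2, a, a + δ / 2}, ?_, fun e he ⟨x, hxe, hxl, hxr⟩ => ?_⟩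
  · rw [← biUnion_preimage_singleton]
    exact (toFinite _).biUnion fun b _ => H.finite_fiber b
  have crosses : ∀ Q : Set ℝ, IsPreconnected Q → Q ⊆ Ioo (a - δ) (a + δ) → a ∉ Q → h x ∈ Q →
      Q ⊆ h '' e := fun Q hQ hsub haQ hxQ =>
    H.subset_image_edge he hQ (disjoint_left.2 fun y hyQ hyV => haQ (hiso y (hsub hyQ) hyV ▸ hyQ))
      ⟨h x, hxQ, mem_image_of_mem h hxe⟩
  rcases lt_trichotomy (h x) a with hlt | heq | hgt
  · obtain ⟨y, hy, hya⟩ := crosses (Ioo (a - δ) a) isPreconnected_Ioo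
      (Ioo_subset_Ioo_right (by linarith)) (fun ha => lt_irrefl _ ha.2) ⟨hxl, hlt⟩
      (show a - δ / 2 ∈ _ from ⟨by linarith, by linarith⟩)
    exact ⟨y, hy, .inl hya⟩
  · exact ⟨x, hxe, .inr (.inl heq)⟩
  · obtain ⟨y, hy, hya⟩ := crosses (Ioo a (a + δ)) isPreconnected_Ioo
      (Ioo_subset_Ioo_left (by linarith)) (fun ha => lt_irrefl _ ha.1) ⟨hgt, hxr⟩
      (show a + δ / 2 ∈ _ from ⟨by linarith, by linarith⟩)
    exact ⟨y, hy, .inr (.inr hya)⟩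

theorem locallyFinite_edges [T2Space R] (H : IsHeight V h) :
    LocallyFinite ((↑) : edges V → Set R) := by
  intro r
  obtain ⟨N, hN, F, hF, hNF⟩ := H.exists_finite_meets_edges (h r)
  refine ⟨h ⁻¹' N, H.continuous.continuousAt.preimage_mem_nhds hN, ?_⟩
  refine ((hF.image (connectedComponentIn Vᶜ)).preimage Subtype.val_injective.injOn).subset ?_
  rintro ⟨e, he⟩ hm
  obtain ⟨y, hye, hyF⟩ := hNF e he hm
  exact ⟨y, hyF, (eq_connectedComponentIn_of_mem_edges he hye).symm⟩

theorem isClosed_of_inter_closure_edge [T2Space R] (H : IsHeight V h) {A : Set R}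
    (hA : ∀ e ∈ edges V, IsClosed (A ∩ closure e)) : IsClosed A := by
  have hcover : A = (A ∩ V) ∪ ⋃ e : edges V, A ∩ closure (e : Set R) := by
    refine Subset.antisymm (fun x hxA => ?_) (union_subset inter_subset_left
      (iUnion_subset fun e => inter_subset_left))
    by_cases hxV : x ∈ V
    · exact .inl ⟨hxA, hxV⟩
    · exact .inr (mem_iUnion.2 ⟨⟨_, x, hxV, rfl⟩, hxA,
        subset_closure (mem_connectedComponentIn hxV)⟩)
  rw [hcover]
  exact (H.isClosed_of_subset inter_subset_right).union
    ((H.locallyFinite_edges.closure.subset fun e => inter_subset_right).isClosed_iUnion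
      fun e => hA e e.2)

theorem edges_nonempty [PreconnectedSpace R] (H : IsHeight V h) (hne : (range h).Nontrivial) :
    (edges V).Nonempty := by
  obtain ⟨r, hr⟩ : ∃ r, r ∉ V := by
    by_contra! hV
    have hV : h '' V = range h := by rw [eq_univ_of_forall hV, image_univ]
    have : DiscreteTopology (range h) := (hV ▸ H.isDiscrete_image).to_subtype
    obtain ⟨_, ⟨r, rfl⟩, _, ⟨s, rfl⟩, hrs⟩ := hne
    exact hrs (congrArg Subtype.val (TotallyDisconnectedSpace.eq_of_continuous
      (rangeFactorization h) H.continuous.rangeFactorization r s))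
  exact ⟨_, r, hr, rfl⟩

theorem isGraphWithEnds [T2Space R] [ConnectedSpace R] (H : IsHeight V h) (hV : V.Nonempty)
    (hne : (range h).Nontrivial) : IsGraphWithEnds R V where
  t2 := inferInstance
  connected := inferInstance
  exists_edge := H.edges_nonempty hne
  edge_homeo _ he := H.nonempty_homeomorph_edge he
  closure_edge _ he := H.nonempty_homeomorph_Icc_or_Ici hV he
  weak_topology _ hA := H.isClosed_of_inter_closure_edge hA

end IsHeight

theorem isIsomorphicToGraph_iff {R : Type} [TopologicalSpace R] {V : Set R}
    (hR : IsGraphWithEnds R V) :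
    IsIsomorphicToGraph R V ↔ ∀ e ∈ edges V, Nonempty (closure e ≃ₜ Icc (-1 : ℝ) 1) := by
  constructor
  · rintro ⟨G, _, W, hG, φ, rfl⟩ _ ⟨r, hr, rfl⟩
    obtain ⟨ψ⟩ := hG.2 _ ⟨φ r, by simpa using hr, rfl⟩
    refine ⟨((φ.image _).trans (Homeomorph.setCongr ?_)).trans ψ⟩
    rw [φ.image_closure, φ.image_connectedComponentIn hr, φ.image_compl]
  · intro h
    exact ⟨R, _, V, ⟨hR, h⟩, Homeomorph.refl R, by simp⟩

/-! ### The strip between two graphs -/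

/-- The closed region between the graphs of `c₁` and `c₂`, which are taken over the second
coordinate axis as in `region`. -/
def strip (c₁ c₂ : ℝ → ℝ) : Set (ℝ × ℝ) := {z | c₁ z.2 ≤ z.1 ∧ z.1 ≤ c₂ z.2}

/-- The part of the strip at level `x`, as a set of second coordinates. -/
def slice (c₁ c₂ : ℝ → ℝ) (x : ℝ) : Set ℝ := {t | c₁ t ≤ x ∧ x ≤ c₂ t}

/-- The set of critical values of the two functions. -/
def criticalValues (c₁ c₂ : ℝ → ℝ) : Set ℝ := c₁ '' criticalSet c₁ ∪ c₂ '' criticalSet c₂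

/-- The point `(x, t)` lies on the graph of `c₁` or of `c₂`, over a critical point of that
function. -/
def IsCriticalAt (c₁ c₂ : ℝ → ℝ) (x t : ℝ) : Prop :=
  (t ∈ criticalSet c₁ ∧ c₁ t = x) ∨ (t ∈ criticalSet c₂ ∧ c₂ t = x)

/-- The functions `c₁ < c₂` are continuous, so that they bound a strip. -/
structure IsStripBoundary (c₁ c₂ : ℝ → ℝ) : Prop where
  continuous₁ : Continuous c₁
  continuous₂ : Continuous c₂
  lt : ∀ t, c₁ t < c₂ t

/-- The strip between `c₁` and `c₂` leaves every compact set of levels as the second coordinate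
tends to infinity, and the critical values form a closed discrete set. -/
structure IsAdmissible (c₁ c₂ : ℝ → ℝ) : Prop extends IsStripBoundary c₁ c₂ where
  escape : ∀ K, IsCompact K → ∀ᶠ t in cocompact ℝ, Disjoint (Icc (c₁ t) (c₂ t)) K
  isClosed_criticalValues : IsClosed (criticalValues c₁ c₂)
  isDiscrete_criticalValues : IsDiscrete (criticalValues c₁ c₂)

section Strip

variable {c₁ c₂ : ℝ → ℝ}

theorem isOpen_setOf_notMem_slice (u : ℝ) : IsOpen {x | u ∉ slice c₁ c₂ x} :=
  (isClosed_Icc (a := c₁ u) (b := c₂ u)).isOpen_compl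

theorem IsCriticalAt.mem_criticalValues {x t : ℝ} (h : IsCriticalAt c₁ c₂ x t) :
    x ∈ criticalValues c₁ c₂ := by
  rcases h with ⟨ht, rfl⟩ | ⟨ht, rfl⟩
  · exact .inl (mem_image_of_mem c₁ ht)
  · exact .inr (mem_image_of_mem c₂ ht)

namespace IsStripBoundary

theorem isClosed_strip (H : IsStripBoundary c₁ c₂) : IsClosed (strip c₁ c₂) :=
  (isClosed_le (H.continuous₁.comp continuous_snd) continuous_fst).inter
    (isClosed_le continuous_fst (H.continuous₂.comp continuous_snd))

theorem isClosed_slice (H : IsStripBoundary c₁ c₂) (x : ℝ) : IsClosed (slice c₁ c₂ x) :=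
  H.isClosed_strip.preimage (Continuous.prodMk_right x)

theorem left_mem_slice (H : IsStripBoundary c₁ c₂) (t : ℝ) : t ∈ slice c₁ c₂ (c₁ t) :=
  ⟨le_rfl, (H.lt t).le⟩

theorem right_mem_slice (H : IsStripBoundary c₁ c₂) (t : ℝ) : t ∈ slice c₁ c₂ (c₂ t) :=
  ⟨(H.lt t).le, le_rfl⟩

theorem mem_slice_of_isCriticalAt (H : IsStripBoundary c₁ c₂) {x t : ℝ}
    (h : IsCriticalAt c₁ c₂ x t) : t ∈ slice c₁ c₂ x := by
  rcases h with ⟨-, rfl⟩ | ⟨-, rfl⟩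
  · exact H.left_mem_slice t
  · exact H.right_mem_slice t

theorem connectedSpace_strip (H : IsStripBoundary c₁ c₂) : ConnectedSpace (strip c₁ c₂) := by
  have h1 := H.continuous₁
  have h2 := H.continuous₂
  have hstrip : strip c₁ c₂ = (fun w : ℝ × ℝ => (AffineMap.lineMap (c₁ w.1) (c₂ w.1) w.2, w.1)) ''
      (univ ×ˢ Icc 0 1) := by
    ext ⟨x, t⟩
    have hseg : t ∈ slice c₁ c₂ x ↔ x ∈ AffineMap.lineMap (c₁ t) (c₂ t) '' Icc (0 : ℝ) 1 := by
      rw [← segment_eq_image_lineMap, segment_eq_Icc (H.lt t).le]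
      rfl
    refine hseg.trans ⟨?_, ?_⟩
    · rintro ⟨s, hs, rfl⟩
      exact ⟨(t, s), ⟨trivial, hs⟩, rfl⟩
    · rintro ⟨⟨t', s⟩, ⟨-, hs⟩, h⟩
      obtain ⟨rfl, rfl⟩ := Prod.mk.inj h
      exact ⟨s, hs, rfl⟩
  refine isConnected_iff_connectedSpace.1 ⟨⟨(c₁ 0, 0), H.left_mem_slice 0⟩, ?_⟩
  rw [hstrip]
  refine (isPreconnected_univ.prod isPreconnected_Icc).image _ (Continuous.continuousOn ?_)
  simp only [AffineMap.lineMap_apply_module]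
  fun_prop

/-- A gap of the slice contains an interior maximum of `c₁` above `x`, or an interior minimum of
`c₂` below `x`. -/
theorem ordConnected_slice_inter_Icc (H : IsStripBoundary c₁ c₂) {x p q : ℝ}
    (h₁ : ∀ w ∈ Icc p q, w ∈ criticalSet c₁ → c₁ w ≤ x)
    (h₂ : ∀ w ∈ Icc p q, w ∈ criticalSet c₂ → x ≤ c₂ w) :
    (slice c₁ c₂ x ∩ Icc p q).OrdConnected := by
  refine ⟨fun s ⟨hs, hspq⟩ t ⟨ht, htpq⟩ => subset_inter (fun u hu => ?_)
    (Icc_subset_Icc hspq.1 htpq.2)⟩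
  have hpq : Icc s t ⊆ Icc p q := Icc_subset_Icc hspq.1 htpq.2
  have hint : ∀ w ∈ Icc s t, w ∉ slice c₁ c₂ x → Icc s t ∈ 𝓝 w := fun w hw hwx =>
    Icc_mem_nhds (lt_of_le_of_ne hw.1 fun h => hwx (h ▸ hs))
      (lt_of_le_of_ne hw.2 fun h => hwx (h ▸ ht))
  constructor
  · by_contra! hxu
    obtain ⟨w, hw, hmax⟩ := isCompact_Icc.exists_isMaxOn ⟨u, hu⟩ H.continuous₁.continuousOn
    have hxw : x < c₁ w := hxu.trans_le (hmax hu)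
    exact hxw.not_ge (h₁ w (hpq hw)
      (hmax.isLocalMax (hint w hw fun h => hxw.not_ge h.1)).deriv_eq_zero)
  · by_contra! hxu
    obtain ⟨w, hw, hmin⟩ := isCompact_Icc.exists_isMinOn ⟨u, hu⟩ H.continuous₂.continuousOn
    have hxw : c₂ w < x := (hmin hu).trans_lt hxu
    exact hxw.not_ge (h₂ w (hpq hw)
      (hmin.isLocalMin (hint w hw fun h => hxw.not_ge h.2)).deriv_eq_zero)

theorem exists_mem_Ioo_of_not_isCriticalAt (H : IsStripBoundary c₁ c₂) {a t : ℝ}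
    (ht : t ∈ slice c₁ c₂ a) (hcr : ¬ IsCriticalAt c₁ c₂ a t) {p q : ℝ} (hpt : p < t)
    (htq : t < q) : ∃ s ∈ Ioo p q, a ∈ Ioo (c₁ s) (c₂ s) := by
  have hpq := Ioo_mem_nhds hpt htq
  rcases ht.1.eq_or_lt with h₁ | h₁
  · have hmin : ¬ IsLocalMin c₁ t := fun hm => hcr (.inl ⟨hm.deriv_eq_zero, h₁⟩)
    have h₂ : ∀ᶠ s in 𝓝 t, a < c₂ s :=
      H.continuous₂.continuousAt.eventually (lt_mem_nhds (h₁ ▸ H.lt t))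
    obtain ⟨s, hs₁, hs₂, hs⟩ := ((not_eventually.1 hmin).and_eventually (h₂.and hpq)).exists
    exact ⟨s, hs, h₁ ▸ not_le.1 hs₁, hs₂⟩
  rcases ht.2.eq_or_lt with h₂ | h₂
  · have hmax : ¬ IsLocalMax c₂ t := fun hm => hcr (.inr ⟨hm.deriv_eq_zero, h₂.symm⟩)
    have h₁ : ∀ᶠ s in 𝓝 t, c₁ s < a := H.continuous₁.continuousAt.eventually (gt_mem_nhds h₁)
    obtain ⟨s, hs₂, hs₁, hs⟩ := ((not_eventually.1 hmax).and_eventually (h₁.and hpq)).exists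
    exact ⟨s, hs, hs₁, h₂ ▸ not_le.1 hs₂⟩
  exact ⟨t, ⟨hpt, htq⟩, h₁, h₂⟩

end IsStripBoundary

namespace IsAdmissible

theorem isProperMap_fst (H : IsAdmissible c₁ c₂) : IsProperMap fun z : strip c₁ c₂ => z.1.1 := by
  have hf : Continuous fun z : strip c₁ c₂ => z.1.1 := by fun_prop
  refine isProperMap_iff_isCompact_preimage.2 ⟨hf, fun K hK => ?_⟩
  obtain ⟨T, hT, hTK⟩ := mem_cocompact.1 (H.escape K hK)
  refine (H.isClosed_strip.isClosedEmbedding_subtypeVal.isCompact_preimage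
    (hK.prod hT)).of_isClosed_subset (hK.isClosed.preimage hf) fun z hz => ⟨hz, ?_⟩
  by_contra hzT
  exact disjoint_left.1 (hTK hzT) z.2 hz

theorem eventually_notMem_slice (H : IsAdmissible c₁ c₂) (x : ℝ) :
    ∀ᶠ t in cocompact ℝ, t ∉ slice c₁ c₂ x :=
  (H.escape {x} isCompact_singleton).mono fun t ht =>
    show x ∉ Icc (c₁ t) (c₂ t) from disjoint_singleton_right.1 ht

theorem isCompact_slice (H : IsAdmissible c₁ c₂) (x : ℝ) : IsCompact (slice c₁ c₂ x) := by
  obtain ⟨T, hT, hTx⟩ := mem_cocompact'.1 (H.eventually_notMem_slice x)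
  exact hT.of_isClosed_subset (H.isClosed_slice x) fun t ht => hTx (not_not.2 ht)

theorem exists_box (H : IsAdmissible c₁ c₂) {a t : ℝ} (ht : t ∈ slice c₁ c₂ a) :
    ∃ p q, p < t ∧ t < q ∧ p ∉ slice c₁ c₂ a ∧ q ∉ slice c₁ c₂ a ∧
      (slice c₁ c₂ a ∩ Icc p q).OrdConnected ∧
      ((∀ w ∈ Icc p q, ¬ IsCriticalAt c₁ c₂ a w) →
        ∀ᶠ x in 𝓝 a, (slice c₁ c₂ x ∩ Icc p q).OrdConnected) := by
  obtain ⟨δ, hδ, hball⟩ := Metric.eventually_nhds_iff_ball.1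
    (eventually_eq_of_mem_of_isDiscrete H.isClosed_criticalValues H.isDiscrete_criticalValues a)
  simp only [Real.ball_eq_Ioo] at hball
  set O := {s | c₁ s < a + δ ∧ a - δ < c₂ s}
  have hO : IsOpen O := (isOpen_lt H.continuous₁ continuous_const).inter
    (isOpen_lt continuous_const H.continuous₂)
  obtain ⟨p, q, hpt, htq, hp, hq, hpq⟩ := exists_Icc_subset_of_isCompact (H.isCompact_slice a) ht
    hO fun s hs => ⟨by linarith [hs.1], by linarith [hs.2]⟩
  have hgap : ∀ x ∈ Ioo (a - δ) (a + δ), (x = a ∨ ∀ w ∈ Icc p q, ¬ IsCriticalAt c₁ c₂ a w) →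
      (slice c₁ c₂ x ∩ Icc p q).OrdConnected := by
    refine fun x hx hxa => H.ordConnected_slice_inter_Icc (fun w hw hwc => ?_) fun w hw hwc => ?_
    · by_contra! hxw
      have hwa : c₁ w = a := hball _ ⟨hx.1.trans hxw, (hpq hw).1⟩ (.inl (mem_image_of_mem c₁ hwc))
      exact hxa.elim (fun h => hxw.ne (h.trans hwa.symm)) fun h => h w hw (.inl ⟨hwc, hwa⟩)
    · by_contra! hxw
      have hwa : c₂ w = a := hball _ ⟨(hpq hw).2, hxw.trans hx.2⟩ (.inr (mem_image_of_mem c₂ hwc))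
      exact hxa.elim (fun h => hxw.ne (hwa.trans h.symm)) fun h => h w hw (.inr ⟨hwc, hwa⟩)
  have hδa : Ioo (a - δ) (a + δ) ∈ 𝓝 a := Ioo_mem_nhds (by linarith) (by linarith)
  exact ⟨p, q, hpt, htq, hp, hq, hgap a (mem_of_mem_nhds hδa) (.inl rfl), fun hcr =>
    mem_of_superset hδa fun x hx => hgap x hx (.inr hcr)⟩

end IsAdmissible

end Strip

/-! ### The space of components of slices -/

/-- `Q` is the quotient map that collapses the components of the slices of the strip, `h` is the
induced height function, and `V` consists of the classes of the critical points. -/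
structure IsContourMap (c₁ c₂ : ℝ → ℝ) {R : Type*} [TopologicalSpace R] (Q : strip c₁ c₂ → R)
    (h : R → ℝ) (V : Set R) : Prop where
  isQuotientMap : IsQuotientMap Q
  eq_iff : ∀ {z z'}, Q z = Q z' ↔ z.1.1 = z'.1.1 ∧ uIcc z.1.2 z'.1.2 ⊆ slice c₁ c₂ z.1.1
  height_apply : ∀ z, h (Q z) = z.1.1
  vertices_eq : V = Q '' {z | IsCriticalAt c₁ c₂ z.1.1 z.1.2}

/-- The classes that lie before `u`, at the levels whose slice does not contain `u`. -/
def before {c₁ c₂ : ℝ → ℝ} {R : Type*} (Q : strip c₁ c₂ → R) (u : ℝ) : Set R :=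
  Q '' {z | u ∉ slice c₁ c₂ z.1.1 ∧ z.1.2 < u}

/-- The classes that lie after `u`, at the levels whose slice does not contain `u`. -/
def after {c₁ c₂ : ℝ → ℝ} {R : Type*} (Q : strip c₁ c₂ → R) (u : ℝ) : Set R :=
  Q '' {z | u ∉ slice c₁ c₂ z.1.1 ∧ u < z.1.2}

namespace IsContourMap

variable {c₁ c₂ : ℝ → ℝ} {R : Type*} [TopologicalSpace R] {Q : strip c₁ c₂ → R} {h : R → ℝ}
  {V : Set R}

theorem continuous (K : IsContourMap c₁ c₂ Q h V) : Continuous Q := K.isQuotientMap.continuous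

theorem continuous_height (K : IsContourMap c₁ c₂ Q h V) : Continuous h := by
  rw [K.isQuotientMap.continuous_iff, show h ∘ Q = fun z => z.1.1 from funext K.height_apply]
  fun_prop

theorem isProperMap_height (K : IsContourMap c₁ c₂ Q h V) (H : IsAdmissible c₁ c₂) :
    IsProperMap h := by
  refine isProperMap_of_comp_of_surj K.continuous K.continuous_height ?_
    K.isQuotientMap.surjective
  rw [show h ∘ Q = fun z => z.1.1 from funext K.height_apply]
  exact H.isProperMap_fst

theorem eq_of_ordConnected (K : IsContourMap c₁ c₂ Q h V) {z z' : strip c₁ c₂} {I : Set ℝ}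
    (hzz : z.1.1 = z'.1.1) (hI : (slice c₁ c₂ z.1.1 ∩ I).OrdConnected) (hz : z.1.2 ∈ I)
    (hz' : z'.1.2 ∈ I) : Q z = Q z' :=
  K.eq_iff.2 ⟨hzz, (hI.uIcc_subset ⟨z.2, hz⟩ ⟨hzz ▸ z'.2, hz'⟩).trans inter_subset_left⟩

theorem mem_before_iff (K : IsContourMap c₁ c₂ Q h V) {z : strip c₁ c₂} {u : ℝ} :
    Q z ∈ before Q u ↔ u ∉ slice c₁ c₂ z.1.1 ∧ z.1.2 < u := by
  refine ⟨?_, fun hz => ⟨z, hz, rfl⟩⟩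
  rintro ⟨z', ⟨hu, hz'⟩, hQ⟩
  obtain ⟨hzz, hsub⟩ := K.eq_iff.1 hQ
  exact ⟨hzz ▸ hu, lt_of_not_ge fun h => hu (hsub (mem_uIcc.2 (.inl ⟨hz'.le, h⟩)))⟩

theorem mem_after_iff (K : IsContourMap c₁ c₂ Q h V) {z : strip c₁ c₂} {u : ℝ} :
    Q z ∈ after Q u ↔ u ∉ slice c₁ c₂ z.1.1 ∧ u < z.1.2 := by
  refine ⟨?_, fun hz => ⟨z, hz, rfl⟩⟩
  rintro ⟨z', ⟨hu, hz'⟩, hQ⟩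
  obtain ⟨hzz, hsub⟩ := K.eq_iff.1 hQ
  exact ⟨hzz ▸ hu, lt_of_not_ge fun h => hu (hsub (mem_uIcc.2 (.inr ⟨h, hz'.le⟩)))⟩

theorem isOpen_before (K : IsContourMap c₁ c₂ Q h V) (u : ℝ) : IsOpen (before Q u) := by
  rw [← K.isQuotientMap.isOpen_preimage]
  have hs : Q ⁻¹' before Q u = {z | u ∉ slice c₁ c₂ z.1.1 ∧ z.1.2 < u} :=
    ext fun z => K.mem_before_iff
  have hfst : Continuous fun z : strip c₁ c₂ => z.1.1 := by fun_prop
  have hsnd : Continuous fun z : strip c₁ c₂ => z.1.2 := by fun_prop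
  rw [hs]
  exact ((isOpen_setOf_notMem_slice u).preimage hfst).inter
    (isOpen_lt hsnd continuous_const)

theorem isOpen_after (K : IsContourMap c₁ c₂ Q h V) (u : ℝ) : IsOpen (after Q u) := by
  rw [← K.isQuotientMap.isOpen_preimage]
  have hs : Q ⁻¹' after Q u = {z | u ∉ slice c₁ c₂ z.1.1 ∧ u < z.1.2} :=
    ext fun z => K.mem_after_iff
  have hfst : Continuous fun z : strip c₁ c₂ => z.1.1 := by fun_prop
  have hsnd : Continuous fun z : strip c₁ c₂ => z.1.2 := by fun_prop
  rw [hs]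
  exact ((isOpen_setOf_notMem_slice u).preimage hfst).inter
    (isOpen_lt continuous_const hsnd)

theorem disjoint_before_after (K : IsContourMap c₁ c₂ Q h V) (u : ℝ) :
    Disjoint (before Q u) (after Q u) := by
  rw [disjoint_left]
  rintro _ ⟨z, hz, rfl⟩ hz'
  exact hz.2.not_gt (K.mem_after_iff.1 hz').2

theorem t2Space (K : IsContourMap c₁ c₂ Q h V) : T2Space R := by
  refine ⟨fun r r' hrr => ?_⟩
  obtain ⟨z, rfl⟩ := K.isQuotientMap.surjective r
  obtain ⟨z', rfl⟩ := K.isQuotientMap.surjective r'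
  by_cases hx : z.1.1 = z'.1.1
  · obtain ⟨u, hu, huz⟩ := not_subset.1 fun hsub => hrr (K.eq_iff.2 ⟨hx, hsub⟩)
    have huz' : u ∉ slice c₁ c₂ z'.1.1 := hx ▸ huz
    have hne : z.1.2 ≠ u := fun h => huz (h ▸ z.2)
    have hne' : z'.1.2 ≠ u := fun h => huz' (h ▸ z'.2)
    rcases mem_uIcc.1 hu with ⟨hzu, huz₂⟩ | ⟨hzu, huz₂⟩
    · exact ⟨before Q u, after Q u, K.isOpen_before u, K.isOpen_after u,
        K.mem_before_iff.2 ⟨huz, hzu.lt_of_ne hne⟩,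
        K.mem_after_iff.2 ⟨huz', huz₂.lt_of_ne hne'.symm⟩, K.disjoint_before_after u⟩
    · exact ⟨after Q u, before Q u, K.isOpen_after u, K.isOpen_before u,
        K.mem_after_iff.2 ⟨huz, huz₂.lt_of_ne hne.symm⟩,
        K.mem_before_iff.2 ⟨huz', hzu.lt_of_ne hne'⟩, (K.disjoint_before_after u).symm⟩
  · exact separated_by_continuous K.continuous_height (by rwa [K.height_apply, K.height_apply])

theorem finite_fiber (K : IsContourMap c₁ c₂ Q h V) (H : IsAdmissible c₁ c₂) (a : ℝ) :
    (h ⁻¹' {a}).Finite := by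
  refine IsCompact.finite ((K.isProperMap_height H).isCompact_preimage isCompact_singleton)
    (isDiscrete_iff_forall_mem_exists_isOpen.2 fun r hr => ?_)
  obtain ⟨z, rfl⟩ := K.isQuotientMap.surjective r
  obtain rfl : z.1.1 = a := (K.height_apply z).symm.trans hr
  obtain ⟨p, q, hpt, htq, hp, hq, hord, -⟩ := H.exists_box z.2
  have hz : Q z ∈ after Q p ∩ before Q q :=
    ⟨K.mem_after_iff.2 ⟨hp, hpt⟩, K.mem_before_iff.2 ⟨hq, htq⟩⟩
  refine ⟨after Q p ∩ before Q q, (K.isOpen_after p).inter (K.isOpen_before q), ?_⟩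
  refine Subset.antisymm ?_ (singleton_subset_iff.2 ⟨hz, hr⟩)
  rintro r' ⟨⟨hr'p, hr'q⟩, hr'⟩
  obtain ⟨z', rfl⟩ := K.isQuotientMap.surjective r'
  have hzz : z'.1.1 = z.1.1 := (K.height_apply z').symm.trans hr'
  exact K.eq_of_ordConnected (I := Icc p q) hzz (hzz ▸ hord)
    ⟨(K.mem_after_iff.1 hr'p).2.le, (K.mem_before_iff.1 hr'q).2.le⟩ ⟨hpt.le, htq.le⟩

/-- A section of the height over the segment of the strip on a line of constant second coordinate
is a local inverse. -/
theorem isLocalHomeomorphOn_height (K : IsContourMap c₁ c₂ Q h V) (H : IsAdmissible c₁ c₂) :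
    IsLocalHomeomorphOn h Vᶜ := by
  refine isLocalHomeomorphOn_of_eventually_inverse K.continuous_height fun r hr => ?_
  obtain ⟨z, rfl⟩ := K.isQuotientMap.surjective r
  obtain ⟨p, q, hpt, htq, hp, hq, hord, hord'⟩ := H.exists_box z.2
  have hcr : ∀ w ∈ Icc p q, ¬ IsCriticalAt c₁ c₂ z.1.1 w := fun w hw hwc => by
    have hwz : Q ⟨(z.1.1, w), H.mem_slice_of_isCriticalAt hwc⟩ = Q z :=
      K.eq_of_ordConnected rfl hord hw ⟨hpt.le, htq.le⟩
    rw [K.vertices_eq, ← hwz] at hr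
    exact hr (mem_image_of_mem Q hwc)
  obtain ⟨s, hs, hzs⟩ := H.exists_mem_Ioo_of_not_isCriticalAt z.2 (hcr _ ⟨hpt.le, htq.le⟩) hpt htq
  set κ : Icc (c₁ s) (c₂ s) → R := fun x => Q ⟨(x, s), x.2⟩
  have hκ : Continuous κ := K.continuous.comp (by fun_prop)
  have hev : ∀ᶠ x in 𝓝 (h (Q z)), x ∈ Icc (c₁ s) (c₂ s) := by
    rw [K.height_apply]
    exact Icc_mem_nhds hzs.1 hzs.2
  refine ⟨IccExtend (H.lt s).le κ, hκ.Icc_extend', ?_, ?_⟩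
  · have hbox : after Q p ∩ before Q q ∈ 𝓝 (Q z) :=
      ((K.isOpen_after p).inter (K.isOpen_before q)).mem_nhds
        ⟨K.mem_after_iff.2 ⟨hp, hpt⟩, K.mem_before_iff.2 ⟨hq, htq⟩⟩
    have hord'' : ∀ᶠ x in 𝓝 (h (Q z)), (slice c₁ c₂ x ∩ Icc p q).OrdConnected := by
      rw [K.height_apply]
      exact hord' hcr
    have hcont : ContinuousAt h (Q z) := K.continuous_height.continuousAt
    filter_upwards [hbox, hcont.eventually hev, hcont.eventually hord''] with r ⟨hrp, hrq⟩ hrs hro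
    obtain ⟨z', rfl⟩ := K.isQuotientMap.surjective r
    rw [IccExtend_of_mem _ _ hrs]
    rw [K.height_apply] at hro
    exact (K.eq_of_ordConnected (K.height_apply z').symm hro
      ⟨(K.mem_after_iff.1 hrp).2.le, (K.mem_before_iff.1 hrq).2.le⟩ ⟨hs.1.le, hs.2.le⟩).symm
  · filter_upwards [hev] with x hx
    rw [IccExtend_of_mem _ _ hx, K.height_apply]

theorem image_vertices (K : IsContourMap c₁ c₂ Q h V) (H : IsStripBoundary c₁ c₂) :
    h '' V = criticalValues c₁ c₂ := by
  rw [K.vertices_eq, image_image]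
  simp only [K.height_apply]
  refine Subset.antisymm ?_ ?_
  · rintro _ ⟨z, hz, rfl⟩
    exact IsCriticalAt.mem_criticalValues hz
  · rintro _ (⟨w, hw, rfl⟩ | ⟨w, hw, rfl⟩)
    · exact ⟨⟨(c₁ w, w), H.left_mem_slice w⟩, .inl ⟨hw, rfl⟩, rfl⟩
    · exact ⟨⟨(c₂ w, w), H.right_mem_slice w⟩, .inr ⟨hw, rfl⟩, rfl⟩

theorem isHeight (K : IsContourMap c₁ c₂ Q h V) (H : IsAdmissible c₁ c₂) : IsHeight V h where
  isProperMap := K.isProperMap_height H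
  finite_fiber := K.finite_fiber H
  isClosed_image := K.image_vertices H.toIsStripBoundary ▸ H.isClosed_criticalValues
  isDiscrete_image := K.image_vertices H.toIsStripBoundary ▸ H.isDiscrete_criticalValues
  isLocalHomeomorphOn := K.isLocalHomeomorphOn_height H

theorem isGraphWithEnds (K : IsContourMap c₁ c₂ Q h V) (H : IsAdmissible c₁ c₂)
    (hcrit : (criticalSet c₁ ∪ criticalSet c₂).Nonempty) : IsGraphWithEnds R V := by
  have := K.t2Space
  have := H.connectedSpace_strip
  have : ConnectedSpace R := K.isQuotientMap.surjective.connectedSpace K.continuous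
  have hV : (h '' V).Nonempty := by
    rw [K.image_vertices H.toIsStripBoundary]
    exact (union_nonempty.1 hcrit).elim (fun h => (h.image c₁).inl) fun h => (h.image c₂).inr
  have hh : ∀ z : strip c₁ c₂, z.1.1 ∈ range h := fun z => ⟨Q z, K.height_apply z⟩
  exact (K.isHeight H).isGraphWithEnds hV.of_image
    ⟨_, hh ⟨(c₁ 0, 0), H.left_mem_slice 0⟩, _, hh ⟨(c₂ 0, 0), H.right_mem_slice 0⟩, (H.lt 0).ne⟩

end IsContourMap

/-! ### Edges of bounded height -/

namespace IsHeight

variable {R : Type*} [TopologicalSpace R] {V e : Set R} {h : R → ℝ}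

theorem mem_frontier_image_edge [T2Space R] (H : IsHeight V h) (he : e ∈ edges V) {r : R}
    (hr : r ∈ closure e) (hre : r ∉ e) : h r ∈ frontier (h '' e) := by
  rw [(H.isOpen_image_edge he).frontier_eq, H.closure_image]
  refine ⟨mem_image_of_mem h hr, ?_⟩
  rintro ⟨s, hs, hsr⟩
  exact hre (H.injOn_closure_edge he (subset_closure hs) hr hsr ▸ hs)

end IsHeight

namespace IsContourMap

variable {c₁ c₂ : ℝ → ℝ} {R : Type*} [TopologicalSpace R] {Q : strip c₁ c₂ → R} {h : R → ℝ}
  {V e : Set R}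

theorem isPreconnected_fiber (K : IsContourMap c₁ c₂ Q h V) (r : R) :
    IsPreconnected (Q ⁻¹' {r}) := by
  obtain ⟨z, rfl⟩ := K.isQuotientMap.surjective r
  rw [← IsInducing.subtypeVal.isPreconnected_image]
  refine isPreconnected_of_forall z.1 ?_
  rintro _ ⟨z', hz', rfl⟩
  obtain ⟨hzz, hsub⟩ := K.eq_iff.1 (show Q z = Q z' from hz'.symm)
  refine ⟨(fun t => (z.1.1, t)) '' uIcc z.1.2 z'.1.2, ?_, ⟨z.1.2, left_mem_uIcc, rfl⟩,
    ⟨z'.1.2, right_mem_uIcc, Prod.ext hzz rfl⟩,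
    isPreconnected_uIcc.image _ (by fun_prop)⟩
  rintro _ ⟨t, ht, rfl⟩
  have hQ : Q z = Q ⟨(z.1.1, t), hsub ht⟩ :=
    K.eq_iff.2 ⟨rfl, (uIcc_subset_uIcc left_mem_uIcc ht).trans hsub⟩
  exact ⟨_, hQ.symm, rfl⟩

/-- Over a critical point `w` lies a vertex, so an edge that meets the segment of the strip over `w`
also ends on that segment. -/
theorem exists_mem_frontier_of_mem_criticalSet (K : IsContourMap c₁ c₂ Q h V)
    (H : IsAdmissible c₁ c₂) (he : e ∈ edges V) {z : strip c₁ c₂} (hz : Q z ∈ e)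
    (hw : z.1.2 ∈ criticalSet c₁ ∪ criticalSet c₂) :
    (Icc (c₁ z.1.2) (c₂ z.1.2) ∩ frontier (h '' e)).Nonempty := by
  have := K.t2Space
  set w := z.1.2
  set κ : Icc (c₁ w) (c₂ w) → R := fun x => Q ⟨(x, w), x.2⟩
  have hκ : Continuous κ := K.continuous.comp (by fun_prop)
  have hrange : IsPreconnected (range κ) := by
    have := isPreconnected_iff_preconnectedSpace.1 (isPreconnected_Icc (a := c₁ w) (b := c₂ w))
    exact isPreconnected_range hκ
  obtain ⟨x, hxV⟩ : ∃ x, κ x ∈ V := by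
    rw [K.vertices_eq]
    rcases hw with hw | hw
    · exact ⟨⟨c₁ w, left_mem_Icc.2 (H.lt w).le⟩, mem_image_of_mem Q (.inl ⟨hw, rfl⟩)⟩
    · exact ⟨⟨c₂ w, right_mem_Icc.2 (H.lt w).le⟩, mem_image_of_mem Q (.inr ⟨hw, rfl⟩)⟩
  by_contra! hempty
  refine subset_compl_of_mem_edges he (hrange.subset_of_closure_inter_subset
    ((K.isHeight H).isOpen_edge he) ⟨Q z, ⟨⟨z.1.1, z.2⟩, rfl⟩, hz⟩ ?_ ⟨x, rfl⟩) hxV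
  rintro _ ⟨hcl, y, rfl⟩
  by_contra hye
  have hy := (K.isHeight H).mem_frontier_image_edge he hcl hye
  rw [K.height_apply] at hy
  exact (hempty ▸ ⟨y.2, hy⟩ : (y : ℝ) ∈ (∅ : Set ℝ))

theorem isBounded_image_edge (K : IsContourMap c₁ c₂ Q h V) (H : IsAdmissible c₁ c₂)
    (hb : ¬ BddBelow (criticalSet c₁ ∪ criticalSet c₂))
    (ha : ¬ BddAbove (criticalSet c₁ ∪ criticalSet c₂)) (he : e ∈ edges V) :
    Bornology.IsBounded (h '' e) := by
  have := K.t2Space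
  have HH := K.isHeight H
  set I : Set ℝ := (fun z : strip c₁ c₂ => z.1.2) '' (Q ⁻¹' e)
  have hI : IsConnected I := (isConnected_preimage_of_isQuotientMap K.isQuotientMap
    K.isPreconnected_fiber (HH.isOpen_edge he) (isConnected_of_mem_edges he)).image _ (by fun_prop)
  obtain ⟨t, ht⟩ := hI.nonempty
  have hfrontier : IsCompact (frontier (h '' e)) := (finite_frontier (HH.isOpen_image_edge he)
    (HH.isConnected_image_edge he).isPreconnected).isCompact
  have hmiss : ∀ᶠ w in cocompact ℝ, w ∈ criticalSet c₁ ∪ criticalSet c₂ → w ∉ I := by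
    filter_upwards [H.escape _ hfrontier] with w hw hwS
    rintro ⟨z, hz, rfl⟩
    exact (K.exists_mem_frontier_of_mem_criticalSet H he hz hwS).ne_empty hw.inter_eq
  obtain ⟨w₁, ⟨hw₁S, hw₁⟩, hw₁t⟩ := (((not_bddBelow_iff_frequently_atBot.1 hb).and_eventually
    (hmiss.filter_mono atBot_le_cocompact)).and_eventually (eventually_lt_atBot t)).exists
  obtain ⟨w₂, ⟨hw₂S, hw₂⟩, hw₂t⟩ := (((not_bddAbove_iff_frequently_atTop.1 ha).and_eventually
    (hmiss.filter_mono atTop_le_cocompact)).and_eventually (eventually_gt_atTop t)).exists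
  have hsub : I ⊆ Icc w₁ w₂ := (subset_Ioo_of_notMem hI.isPreconnected.ordConnected ht hw₁t hw₂t
    (hw₁ hw₁S) (hw₂ hw₂S)).trans Ioo_subset_Icc_self
  obtain ⟨m, hm⟩ := isCompact_Icc.bddBelow_image (K := Icc w₁ w₂) H.continuous₁.continuousOn
  obtain ⟨M, hM⟩ := isCompact_Icc.bddAbove_image (K := Icc w₁ w₂) H.continuous₂.continuousOn
  refine (Metric.isBounded_Icc m M).subset ?_
  rintro _ ⟨r, hr, rfl⟩
  obtain ⟨z, rfl⟩ := K.isQuotientMap.surjective r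
  have hz : z.1.2 ∈ Icc w₁ w₂ := hsub ⟨z, hr, rfl⟩
  rw [K.height_apply]
  exact ⟨(hm (mem_image_of_mem c₁ hz)).trans z.2.1, z.2.2.trans (hM (mem_image_of_mem c₂ hz))⟩

theorem exists_not_isBounded_image_edge (K : IsContourMap c₁ c₂ Q h V) (H : IsAdmissible c₁ c₂)
    {l : Filter ℝ} [l.NeBot] (hl : l ≤ cocompact ℝ)
    (hconn : ∀ s ∈ l, ∃ P ∈ l, P ⊆ s ∧ IsPreconnected P) {T : ℝ}
    (hT : ∀ᶠ t in l, ∀ w ∈ criticalSet c₁ ∪ criticalSet c₂, T ∈ uIcc w t) :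
    ∃ e ∈ edges V, ¬ Bornology.IsBounded (h '' e) := by
  set κ : ℝ → R := fun t => Q ⟨(c₁ t, t), H.left_mem_slice t⟩
  have hκ : Continuous κ := K.continuous.comp
    ((H.continuous₁.prodMk continuous_id).subtype_mk H.left_mem_slice)
  have hκV : ∀ᶠ t in l, κ t ∉ V := by
    filter_upwards [hT, (H.escape _ (isCompact_Icc (a := c₁ T) (b := c₂ T))).filter_mono hl]
      with t htT ht
    rw [K.vertices_eq]
    rintro ⟨z, hz, hzt⟩
    obtain ⟨hzx, hsub⟩ := K.eq_iff.1 hzt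
    have hTz : z.1.1 ∈ Icc (c₁ T) (c₂ T) := hsub (htT _ (hz.imp And.left And.left))
    rw [hzx] at hTz
    exact disjoint_left.1 ht (left_mem_Icc.2 (H.lt t).le) hTz
  obtain ⟨P, hPl, hPV, hP⟩ := hconn _ hκV
  obtain ⟨t, ht⟩ := Filter.nonempty_of_mem hPl
  refine ⟨_, ⟨κ t, hPV ht, rfl⟩, fun hb => ?_⟩
  set e := connectedComponentIn Vᶜ (κ t)
  have hPe : κ '' P ⊆ e := (hP.image κ hκ.continuousOn).subset_connectedComponentIn
    (mem_image_of_mem κ ht) (image_subset_iff.2 hPV)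
  obtain ⟨s, hs, hsP⟩ := (((H.escape _ hb.isCompact_closure).filter_mono hl).and hPl).exists
  refine disjoint_left.1 hs (left_mem_Icc.2 (H.lt s).le) (subset_closure ?_)
  exact ⟨κ s, hPe (mem_image_of_mem κ hsP), K.height_apply _⟩

theorem exists_not_isBounded_image_edge_of_bddAbove (K : IsContourMap c₁ c₂ Q h V)
    (H : IsAdmissible c₁ c₂) (ha : BddAbove (criticalSet c₁ ∪ criticalSet c₂)) :
    ∃ e ∈ edges V, ¬ Bornology.IsBounded (h '' e) := by
  obtain ⟨T, hT⟩ := ha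
  refine K.exists_not_isBounded_image_edge H atTop_le_cocompact (fun s hs => ?_) (T := T) ?_
  · obtain ⟨N, hN⟩ := mem_atTop_sets.1 hs
    exact ⟨Ici N, Ici_mem_atTop N, hN, isPreconnected_Ici⟩
  · filter_upwards [eventually_ge_atTop T] with t ht w hw
    exact mem_uIcc.2 (.inl ⟨hT hw, ht⟩)

theorem exists_not_isBounded_image_edge_of_bddBelow (K : IsContourMap c₁ c₂ Q h V)
    (H : IsAdmissible c₁ c₂) (hb : BddBelow (criticalSet c₁ ∪ criticalSet c₂)) :
    ∃ e ∈ edges V, ¬ Bornology.IsBounded (h '' e) := by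
  obtain ⟨T, hT⟩ := hb
  refine K.exists_not_isBounded_image_edge H atBot_le_cocompact (fun s hs => ?_) (T := T) ?_
  · obtain ⟨N, hN⟩ := mem_atBot_sets.1 hs
    exact ⟨Iic N, Iic_mem_atBot N, hN, isPreconnected_Iic⟩
  · filter_upwards [eventually_le_atBot T] with t ht w hw
    exact mem_uIcc.2 (.inr ⟨ht, hT hw⟩)

theorem forall_isBounded_image_edge_iff (K : IsContourMap c₁ c₂ Q h V) (H : IsAdmissible c₁ c₂) :
    (∀ e ∈ edges V, Bornology.IsBounded (h '' e)) ↔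
      ¬ BddBelow (criticalSet c₁ ∪ criticalSet c₂) ∧
      ¬ BddAbove (criticalSet c₁ ∪ criticalSet c₂) := by
  refine ⟨fun hall => ⟨fun hb => ?_, fun ha => ?_⟩, fun ⟨hb, ha⟩ _ he =>
    K.isBounded_image_edge H hb ha he⟩
  · obtain ⟨e, he, hne⟩ := K.exists_not_isBounded_image_edge_of_bddBelow H hb
    exact hne (hall e he)
  · obtain ⟨e, he, hne⟩ := K.exists_not_isBounded_image_edge_of_bddAbove H ha
    exact hne (hall e he)

theorem isIsomorphicToGraph_iff {R : Type} [TopologicalSpace R] {Q : strip c₁ c₂ → R} {h : R → ℝ}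
    {V : Set R} (K : IsContourMap c₁ c₂ Q h V) (H : IsAdmissible c₁ c₂)
    (hcrit : (criticalSet c₁ ∪ criticalSet c₂).Nonempty) :
    IsIsomorphicToGraph R V ↔ ¬ BddBelow (criticalSet c₁ ∪ criticalSet c₂) ∧
      ¬ BddAbove (criticalSet c₁ ∪ criticalSet c₂) := by
  have := K.t2Space
  rw [Reeb.isIsomorphicToGraph_iff (K.isGraphWithEnds H hcrit),
    ← K.forall_isBounded_image_edge_iff H]
  exact forall₂_congr fun e he => (K.isHeight H).nonempty_homeomorph_Icc_iff he

end IsContourMap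

/-! ### Contours -/

section Contour

variable {X : Type*} [TopologicalSpace X] {f : X → ℝ} {x y : X}

theorem mem_contour_self : x ∈ contour f x := mem_connectedComponentIn rfl

theorem apply_eq_of_mem_contour (hy : y ∈ contour f x) : f y = f x :=
  connectedComponentIn_subset (f ⁻¹' {f x}) x hy

theorem quotientMap_eq_iff : quotientMap f x = quotientMap f y ↔ y ∈ contour f x := by
  have hq : quotientMap f x = quotientMap f y ↔ contour f x = contour f y := Quotient.eq
  refine hq.trans ⟨fun h => h ▸ mem_contour_self, fun h => ?_⟩
  unfold contour
  rw [apply_eq_of_mem_contour h]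
  exact connectedComponentIn_eq h

variable (f) in
/-- The height function on the Reeb space, which is induced by `f`. -/
def height : ReebSpace f → ℝ :=
  Quotient.lift f fun _ _ h =>
    (apply_eq_of_mem_contour (quotientMap_eq_iff.1 (Quotient.sound h))).symm

end Contour

/-! ### The manifold over the strip -/

/-- The radius of the sphere that is the fibre of the manifold over the point `z` of the strip. -/
noncomputable def fiberRadius (c₁ c₂ : ℝ → ℝ) (z : ℝ × ℝ) : ℝ :=
  √((z.1 - c₁ z.2) * (c₂ z.2 - z.1))

section Manifold

variable {c₁ c₂ : ℝ → ℝ} {m : ℕ}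

theorem fiberRadius_nonneg (z : ℝ × ℝ) : 0 ≤ fiberRadius c₁ c₂ z := Real.sqrt_nonneg _

theorem fiberRadius_eq_zero_iff {z : ℝ × ℝ} (hz : z ∈ strip c₁ c₂) :
    fiberRadius c₁ c₂ z = 0 ↔ z.1 = c₁ z.2 ∨ z.1 = c₂ z.2 := by
  rw [fiberRadius, Real.sqrt_eq_zero (mul_nonneg (sub_nonneg.2 hz.1) (sub_nonneg.2 hz.2)),
    mul_eq_zero, sub_eq_zero, sub_eq_zero, eq_comm (a := c₂ z.2)]

namespace IsStripBoundary

theorem closure_region (H : IsStripBoundary c₁ c₂) : closure (region c₁ c₂) = strip c₁ c₂ := by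
  refine Subset.antisymm (closure_minimal (fun z hz => ⟨hz.1.le, hz.2.le⟩) H.isClosed_strip) ?_
  rintro ⟨x, t⟩ hx
  have hx' : x ∈ closure (Ioo (c₁ t) (c₂ t)) := by
    rw [closure_Ioo (H.lt t).ne]
    exact hx
  exact map_mem_closure (f := fun y => (y, t)) (by fun_prop) hx' fun y hy => hy

theorem mem_manifoldX_iff (H : IsStripBoundary c₁ c₂) {p : Ambient m} :
    p ∈ manifoldX m c₁ c₂ ↔ p.1 ∈ strip c₁ c₂ ∧ ‖p.2‖ = fiberRadius c₁ c₂ p.1 := by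
  rw [manifoldX, mem_ofPred_eq, H.closure_region]
  refine and_congr_right fun hp => ?_
  have hnonneg := mul_nonneg (sub_nonneg.2 hp.1) (sub_nonneg.2 hp.2)
  rw [fiberRadius, eq_comm (a := ‖p.2‖), Real.sqrt_eq_iff_eq_sq hnonneg (norm_nonneg _),
    EuclideanSpace.real_norm_sq_eq, sub_eq_zero]

theorem continuous_fiberRadius (H : IsStripBoundary c₁ c₂) : Continuous (fiberRadius c₁ c₂) := by
  have h1 := H.continuous₁
  have h2 := H.continuous₂
  unfold fiberRadius
  fun_prop

/-- The projection of the manifold onto the strip. -/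
def toStrip (H : IsStripBoundary c₁ c₂) (p : manifoldX m c₁ c₂) : strip c₁ c₂ :=
  ⟨p.1.1, (H.mem_manifoldX_iff.1 p.2).1⟩

/-- The point of the manifold over `z` in the direction `v`; for fixed `v` this is a section of the
projection onto the strip. -/
noncomputable def lift (H : IsStripBoundary c₁ c₂) (z : strip c₁ c₂)
    (v : Metric.sphere (0 : EuclideanSpace ℝ (Fin (m - 1))) 1) : manifoldX m c₁ c₂ :=
  ⟨(z.1, fiberRadius c₁ c₂ z.1 • v.1), H.mem_manifoldX_iff.2 ⟨z.2, by
    rw [norm_smul, norm_eq_of_mem_sphere, mul_one, Real.norm_of_nonneg (fiberRadius_nonneg _)]⟩⟩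

theorem continuous_lift (H : IsStripBoundary c₁ c₂) :
    Continuous fun q : strip c₁ c₂ × Metric.sphere (0 : EuclideanSpace ℝ (Fin (m - 1))) 1 =>
      H.lift q.1 q.2 := by
  have hr := H.continuous_fiberRadius
  unfold lift
  fun_prop

theorem fiberRadius_eq_zero_of_frequently (H : IsStripBoundary c₁ c₂) {x α : ℝ}
    (hα : α ∈ slice c₁ c₂ x) (hf : ∃ᶠ s in 𝓝 α, s ∉ slice c₁ c₂ x) :
    fiberRadius c₁ c₂ (x, α) = 0 := by
  rw [fiberRadius_eq_zero_iff hα]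
  by_contra! hne
  refine hf ?_
  filter_upwards [H.continuous₁.continuousAt.eventually (gt_mem_nhds (hα.1.lt_of_ne' hne.1)),
    H.continuous₂.continuousAt.eventually (lt_mem_nhds (hα.2.lt_of_ne hne.2))] with s h₁ h₂
  exact not_not.2 ⟨h₁.le, h₂.le⟩

variable [Nontrivial (EuclideanSpace ℝ (Fin (m - 1)))]

theorem exists_lift_eq (H : IsStripBoundary c₁ c₂) (p : manifoldX m c₁ c₂) :
    ∃ v, H.lift (H.toStrip p) v = p := by
  obtain ⟨v, hv⟩ : ∃ v : Metric.sphere (0 : EuclideanSpace ℝ (Fin (m - 1))) 1,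
      ‖p.1.2‖ • v.1 = p.1.2 := by
    by_cases hp : p.1.2 = 0
    · obtain ⟨v, hv⟩ :=
        (NormedSpace.sphere_nonempty (x := (0 : EuclideanSpace ℝ (Fin (m - 1))))).2 zero_le_one
      exact ⟨⟨v, hv⟩, by rw [hp, norm_zero, zero_smul]⟩
    · have hn : ‖p.1.2‖ ≠ 0 := norm_ne_zero_iff.2 hp
      exact ⟨⟨‖p.1.2‖⁻¹ • p.1.2, by simp [norm_smul, hn]⟩, smul_inv_smul₀ hn _⟩
  refine ⟨v, Subtype.ext (Prod.ext rfl ?_)⟩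
  rw [(H.mem_manifoldX_iff.1 p.2).2] at hv
  exact hv

theorem isPreconnected_setOf_mem_Icc (H : IsStripBoundary c₁ c₂) {x α β : ℝ}
    (hsub : Icc α β ⊆ slice c₁ c₂ x) (hα : fiberRadius c₁ c₂ (x, α) = 0) :
    IsPreconnected {p : manifoldX m c₁ c₂ | p.1.1.1 = x ∧ p.1.1.2 ∈ Icc α β} := by
  rcases lt_or_ge β α with hlt | hle
  · simp [Icc_eq_empty hlt.not_ge, isPreconnected_empty]
  have : PreconnectedSpace (Icc α β) := isPreconnected_iff_preconnectedSpace.1 isPreconnected_Icc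
  set a : manifoldX m c₁ c₂ :=
    ⟨((x, α), 0), H.mem_manifoldX_iff.2 ⟨hsub (left_mem_Icc.2 hle), by rw [norm_zero, hα]⟩⟩
  refine isPreconnected_of_forall a fun p ⟨hpx, hpt⟩ => ?_
  obtain ⟨v, hv⟩ := H.exists_lift_eq p
  set arc : Icc α β → strip c₁ c₂ := fun s => ⟨(x, s), hsub s.2⟩
  have harc : Continuous arc := by fun_prop
  refine ⟨range fun s => H.lift (arc s) v, ?_, ⟨⟨α, left_mem_Icc.2 hle⟩, ?_⟩,
    ⟨⟨p.1.1.2, hpt⟩, ?_⟩, isPreconnected_range (H.continuous_lift.comp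
      (harc.prodMk continuous_const))⟩
  · rintro _ ⟨s, rfl⟩
    exact ⟨rfl, s.2⟩
  · exact Subtype.ext (Prod.ext rfl (by simp [lift, hα, a, arc]))
  · have hz : arc ⟨p.1.1.2, hpt⟩ = H.toStrip p := Subtype.ext (Prod.ext hpx.symm rfl)
    exact (congrArg (H.lift · v) hz).trans hv

end IsStripBoundary

namespace IsAdmissible

variable [Nontrivial (EuclideanSpace ℝ (Fin (m - 1)))]

theorem isProperMap_proj (H : IsAdmissible c₁ c₂) :
    IsProperMap ((manifoldX m c₁ c₂).domRestrict (proj m)) := by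
  have hproj : Continuous ((manifoldX m c₁ c₂).domRestrict (proj m)) :=
    (continuous_fst.comp continuous_fst).comp continuous_subtype_val
  refine isProperMap_of_comp_of_surj H.continuous_lift hproj
    (H.isProperMap_fst.comp isProperMap_fst_of_compactSpace) fun p => ?_
  obtain ⟨v, hv⟩ := H.exists_lift_eq p
  exact ⟨(H.toStrip p, v), hv⟩

/-- The part of the manifold over a component `Icc α β` of a slice is connected, since the fibre
over `α` is a single point. -/
theorem mem_contour_iff (H : IsAdmissible c₁ c₂) {p p' : manifoldX m c₁ c₂} :
    p' ∈ contour ((manifoldX m c₁ c₂).domRestrict (proj m)) p ↔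
      p.1.1.1 = p'.1.1.1 ∧ uIcc p.1.1.2 p'.1.1.2 ⊆ slice c₁ c₂ p.1.1.1 := by
  set f := (manifoldX m c₁ c₂).domRestrict (proj m)
  constructor
  · intro hp'
    refine ⟨(apply_eq_of_mem_contour hp').symm, ?_⟩
    have hc : IsPreconnected ((fun y : manifoldX m c₁ c₂ => y.1.1.2) '' contour f p) :=
      isPreconnected_connectedComponentIn.image _ (by fun_prop)
    refine (hc.ordConnected.uIcc_subset (mem_image_of_mem _ mem_contour_self)
      (mem_image_of_mem _ hp')).trans ?_
    rintro _ ⟨y, hy, rfl⟩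
    have hyp : y.1.1.1 = p.1.1.1 := apply_eq_of_mem_contour (f := f) hy
    exact hyp ▸ (H.toStrip y).2
  · rintro ⟨hpp, hsub⟩
    obtain ⟨α, β, hC, hα, -⟩ :=
      exists_connectedComponentIn_eq_Icc (H.isCompact_slice p.1.1.1) (hsub left_mem_uIcc)
    have hIcc : Icc α β ⊆ slice c₁ c₂ p.1.1.1 := hC ▸ connectedComponentIn_subset _ _
    have huIcc : uIcc p.1.1.2 p'.1.1.2 ⊆ Icc α β :=
      hC ▸ isPreconnected_uIcc.subset_connectedComponentIn left_mem_uIcc hsub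
    have hαβ : α ≤ β := nonempty_Icc.1 ⟨_, huIcc left_mem_uIcc⟩
    have hr : fiberRadius c₁ c₂ (p.1.1.1, α) = 0 := H.fiberRadius_eq_zero_of_frequently
      (hIcc (left_mem_Icc.2 hαβ)) (hα.filter_mono nhdsWithin_le_nhds)
    exact (H.isPreconnected_setOf_mem_Icc hIcc hr).subset_connectedComponentIn
      ⟨rfl, huIcc left_mem_uIcc⟩ (fun q hq => hq.1) ⟨hpp.symm, huIcc right_mem_uIcc⟩

end IsAdmissible

end Manifold

/-! ### Critical points of the projection -/

theorem deriv_eq_zero_of_isLocalExtr_sub_comp {x t c : ℝ → ℝ} {a : ℝ} (hx : DifferentiableAt ℝ x a)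
    (ht : DifferentiableAt ℝ t a) (hc : DifferentiableAt ℝ c (t a)) (hcr : deriv c (t a) = 0)
    (hext : IsLocalExtr (fun s => x s - c (t s)) a) : deriv x a = 0 := by
  have hsub := hx.hasDerivAt.sub (hc.hasDerivAt.comp a ht.hasDerivAt)
  simpa [hcr] using hext.hasDerivAt_eq_zero hsub

namespace IsStripBoundary

variable {c₁ c₂ : ℝ → ℝ} {m : ℕ} {p : Ambient m}

theorem isCriticalPointOn_of_isCriticalAt (H : IsStripBoundary c₁ c₂) (hc₁ : Differentiable ℝ c₁)
    (hc₂ : Differentiable ℝ c₂) (hp : p ∈ manifoldX m c₁ c₂)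
    (h : IsCriticalAt c₁ c₂ p.1.1 p.1.2) : IsCriticalPointOn (manifoldX m c₁ c₂) (proj m) p := by
  refine ⟨hp, fun ε γ hε hγ hγX hγ0 => ?_⟩
  have hnhds : Ioo (-ε) ε ∈ 𝓝 (0 : ℝ) := Ioo_mem_nhds (neg_lt_zero.2 hε) hε
  have hd : DifferentiableAt ℝ γ 0 := (hγ.contDiffAt hnhds).differentiableAt (by simp)
  have hmem : ∀ᶠ s in 𝓝 (0 : ℝ), (γ s).1 ∈ strip c₁ c₂ := by
    filter_upwards [hnhds] with s hs
    exact (H.mem_manifoldX_iff.1 (hγX s hs)).1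
  subst hγ0
  rcases h with ⟨hcr, hval⟩ | ⟨hcr, hval⟩
  · refine deriv_eq_zero_of_isLocalExtr_sub_comp hd.fst.fst hd.fst.snd (hc₁ _) hcr (.inl ?_)
    filter_upwards [hmem] with s hs
    exact (sub_eq_zero.2 hval.symm).trans_le (sub_nonneg.2 hs.1)
  · refine deriv_eq_zero_of_isLocalExtr_sub_comp hd.fst.fst hd.fst.snd (hc₂ _) hcr (.inr ?_)
    filter_upwards [hmem] with s hs
    exact (sub_nonpos.2 hs.2).trans_eq (sub_eq_zero.2 hval.symm).symm

/-- Over an interior point of the strip, a segment of constant second coordinate lifts to a smooth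
curve along which the projection has derivative `1`. -/
theorem snd_eq_zero_of_isCriticalPointOn (H : IsStripBoundary c₁ c₂)
    (h : IsCriticalPointOn (manifoldX m c₁ c₂) (proj m) p) : p.2 = 0 := by
  by_contra hy
  obtain ⟨hps, hpn⟩ := H.mem_manifoldX_iff.1 h.1
  have hr : fiberRadius c₁ c₂ p.1 ≠ 0 := hpn ▸ norm_ne_zero_iff.2 hy
  have hne := not_or.1 (mt (fiberRadius_eq_zero_iff hps).2 hr)
  obtain ⟨ε, hε, hball⟩ := Metric.mem_nhds_iff.1
    (Ioo_mem_nhds (hps.1.lt_of_ne' hne.1) (hps.2.lt_of_ne hne.2))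
  have hIoo : ∀ s ∈ Ioo (-ε) ε, p.1.1 + s ∈ Ioo (c₁ p.1.2) (c₂ p.1.2) := fun s hs =>
    hball (by simpa [Real.dist_eq, abs_lt] using hs)
  set w := ‖p.2‖⁻¹ • p.2
  have hw : ‖w‖ = 1 := norm_smul_inv_norm hy
  set γ : ℝ → Ambient m := fun s => ((p.1.1 + s, p.1.2), fiberRadius c₁ c₂ (p.1.1 + s, p.1.2) • w)
  have hγ : ContDiffOn ℝ ∞ γ (Ioo (-ε) ε) := by
    refine ContDiffOn.prodMk (by fun_prop) (ContDiffOn.smul (ContDiffOn.sqrt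
      (by dsimp only; fun_prop) fun s hs => ?_) contDiffOn_const)
    exact (mul_pos (sub_pos.2 (hIoo s hs).1) (sub_pos.2 (hIoo s hs).2)).ne'
  have hγX : ∀ s ∈ Ioo (-ε) ε, γ s ∈ manifoldX m c₁ c₂ := fun s hs =>
    H.mem_manifoldX_iff.2 ⟨⟨(hIoo s hs).1.le, (hIoo s hs).2.le⟩, by
      rw [norm_smul, hw, mul_one, Real.norm_of_nonneg (fiberRadius_nonneg _)]⟩
  have hγ0 : γ 0 = p := by
    simp only [γ, w, add_zero, ← hpn, Prod.mk.eta, smul_inv_smul₀ (norm_ne_zero_iff.2 hy)]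
  have hderiv : HasDerivAt (fun s => proj m (γ s)) 1 0 := (hasDerivAt_id (0 : ℝ)).const_add p.1.1
  exact one_ne_zero (hderiv.deriv.symm.trans (h.2 ε γ hε hγ hγX hγ0))

theorem mem_criticalSet_of_isCriticalPointOn (H : IsStripBoundary c₁ c₂)
    (h : IsCriticalPointOn (manifoldX m c₁ c₂) (proj m) p) {c : ℝ → ℝ} (hc : ContDiff ℝ ∞ c)
    (hcr : ∀ s, (c s, s) ∈ strip c₁ c₂ ∧ fiberRadius c₁ c₂ (c s, s) = 0) (hp : p.1.1 = c p.1.2) :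
    p.1.2 ∈ criticalSet c := by
  have hzero := h.2 1 (fun s => ((c (p.1.2 + s), p.1.2 + s), 0)) one_pos
    (ContDiff.contDiffOn (by fun_prop))
    (fun s _ => H.mem_manifoldX_iff.2 ⟨(hcr _).1, by rw [norm_zero, (hcr _).2]⟩)
    (Prod.ext (Prod.ext (by simp [hp]) (add_zero _)) (H.snd_eq_zero_of_isCriticalPointOn h).symm)
  simp only [proj] at hzero
  rwa [deriv_comp_const_add, add_zero] at hzero

theorem isCriticalAt_of_isCriticalPointOn (H : IsStripBoundary c₁ c₂) (hc₁ : ContDiff ℝ ∞ c₁)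
    (hc₂ : ContDiff ℝ ∞ c₂) (h : IsCriticalPointOn (manifoldX m c₁ c₂) (proj m) p) :
    IsCriticalAt c₁ c₂ p.1.1 p.1.2 := by
  obtain ⟨hps, hpn⟩ := H.mem_manifoldX_iff.1 h.1
  rw [H.snd_eq_zero_of_isCriticalPointOn h, norm_zero, eq_comm, fiberRadius_eq_zero_iff hps] at hpn
  rcases hpn with hx | hx
  · exact .inl ⟨H.mem_criticalSet_of_isCriticalPointOn h hc₁ (fun s =>
      ⟨H.left_mem_slice s, (fiberRadius_eq_zero_iff (H.left_mem_slice s)).2 (.inl rfl)⟩) hx,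
      hx.symm⟩
  · exact .inr ⟨H.mem_criticalSet_of_isCriticalPointOn h hc₂ (fun s =>
      ⟨H.right_mem_slice s, (fiberRadius_eq_zero_iff (H.right_mem_slice s)).2 (.inr rfl)⟩) hx,
      hx.symm⟩

end IsStripBoundary

theorem IsAdmissible.isContourMap {c₁ c₂ : ℝ → ℝ} {m : ℕ}
    [Nontrivial (EuclideanSpace ℝ (Fin (m - 1)))] (H : IsAdmissible c₁ c₂)
    (hc₁ : ContDiff ℝ ∞ c₁) (hc₂ : ContDiff ℝ ∞ c₂)
    (v : Metric.sphere (0 : EuclideanSpace ℝ (Fin (m - 1))) 1) :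
    IsContourMap c₁ c₂
      (fun z => quotientMap ((manifoldX m c₁ c₂).domRestrict (proj m)) (H.lift z v))
      (height ((manifoldX m c₁ c₂).domRestrict (proj m)))
      (criticalContours (manifoldX m c₁ c₂) (proj m)) := by
  set f := (manifoldX m c₁ c₂).domRestrict (proj m)
  have hq : IsQuotientMap (quotientMap f) := isQuotientMap_quotient_mk'
  have heq : ∀ p, quotientMap f (H.lift (H.toStrip p) v) = quotientMap f p := fun p =>
    quotientMap_eq_iff.2 (H.mem_contour_iff.2 ⟨rfl, by
      rw [show (H.lift (H.toStrip p) v).1.1.2 = p.1.1.2 from rfl, uIcc_self]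
      exact singleton_subset_iff.2 (H.toStrip p).2⟩)
  have htoStrip : Continuous (H.toStrip (m := m)) :=
    (continuous_fst.comp continuous_subtype_val).subtype_mk _
  have hlift : Continuous fun z => H.lift z v :=
    H.continuous_lift.comp (continuous_id.prodMk continuous_const)
  refine ⟨.of_comp htoStrip (hq.continuous.comp hlift) ?_,
    quotientMap_eq_iff.trans H.mem_contour_iff, fun z => rfl, ?_⟩
  · rwa [show (fun z => quotientMap f (H.lift z v)) ∘ H.toStrip = quotientMap f from funext heq]
  · ext r
    constructor
    · rintro ⟨p, hp, rfl⟩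
      exact ⟨H.toStrip p, H.isCriticalAt_of_isCriticalPointOn hc₁ hc₂ hp, heq p⟩
    · rintro ⟨z, hz, rfl⟩
      exact ⟨H.lift z v, H.isCriticalPointOn_of_isCriticalAt (hc₁.differentiable (by simp))
        (hc₂.differentiable (by simp)) (H.lift z v).2 hz, rfl⟩

theorem eventually_disjoint_Icc_of_tendsto {ι : Type*} {l : Filter ι} {c₁ c₂ : ι → ℝ}
    (h : (Tendsto c₁ l atTop ∧ Tendsto c₂ l atTop) ∨ (Tendsto c₁ l atBot ∧ Tendsto c₂ l atBot))
    {K : Set ℝ} (hK : IsCompact K) : ∀ᶠ t in l, Disjoint (Icc (c₁ t) (c₂ t)) K := by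
  rcases h with h | h
  · obtain ⟨b, hb⟩ := hK.bddAbove
    filter_upwards [h.1.eventually_gt_atTop b] with t ht
    exact disjoint_left.2 fun x hx hxK => ((hb hxK).trans_lt ht).not_ge hx.1
  · obtain ⟨b, hb⟩ := hK.bddBelow
    filter_upwards [h.2.eventually_lt_atBot b] with t ht
    exact disjoint_left.2 fun x hx hxK => (ht.trans_le (hb hxK)).not_ge hx.2

end Reeb

theorem theorem4 (m : ℕ) (hm : 2 ≤ m) (c₁ c₂ : ℝ → ℝ)
    (hc₁ : ContDiff ℝ ∞ c₁) (hc₂ : ContDiff ℝ ∞ c₂) (hlt : ∀ t, c₁ t < c₂ t)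
    (hclosed : IsClosed (c₁ '' Reeb.criticalSet c₁ ∪ c₂ '' Reeb.criticalSet c₂))
    (hdiscrete : IsDiscrete (c₁ '' Reeb.criticalSet c₁ ∪ c₂ '' Reeb.criticalSet c₂))
    (hcrit : (Reeb.criticalSet c₁ ∪ Reeb.criticalSet c₂).Nonempty)
    (hleft : (Tendsto c₁ atBot atTop ∧ Tendsto c₂ atBot atTop) ∨
      (Tendsto c₁ atBot atBot ∧ Tendsto c₂ atBot atBot))
    (hright : (Tendsto c₁ atTop atTop ∧ Tendsto c₂ atTop atTop) ∨
      (Tendsto c₁ atTop atBot ∧ Tendsto c₂ atTop atBot)) :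
    IsProperMap ((Reeb.manifoldX m c₁ c₂).domRestrict (Reeb.proj m)) ∧
    Reeb.IsGraphWithEnds (Reeb.ReebSpace ((Reeb.manifoldX m c₁ c₂).domRestrict (Reeb.proj m)))
      (Reeb.criticalContours (Reeb.manifoldX m c₁ c₂) (Reeb.proj m)) ∧
    (Reeb.IsIsomorphicToGraph
        (Reeb.ReebSpace ((Reeb.manifoldX m c₁ c₂).domRestrict (Reeb.proj m)))
        (Reeb.criticalContours (Reeb.manifoldX m c₁ c₂) (Reeb.proj m)) ↔
      ¬ BddBelow (Reeb.criticalSet c₁ ∪ Reeb.criticalSet c₂) ∧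
      ¬ BddAbove (Reeb.criticalSet c₁ ∪ Reeb.criticalSet c₂)) := by
  have H : Reeb.IsAdmissible c₁ c₂ := by
    refine ⟨⟨hc₁.continuous, hc₂.continuous, hlt⟩, fun K hK => ?_, hclosed, hdiscrete⟩
    rw [cocompact_eq_atBot_atTop, eventually_sup]
    exact ⟨Reeb.eventually_disjoint_Icc_of_tendsto hleft hK,
      Reeb.eventually_disjoint_Icc_of_tendsto hright hK⟩
  have : Nonempty (Fin (m - 1)) := ⟨⟨0, by omega⟩⟩
  obtain ⟨v, hv⟩ :=
    (NormedSpace.sphere_nonempty (x := (0 : EuclideanSpace ℝ (Fin (m - 1))))).2 zero_le_one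
  have K := H.isContourMap hc₁ hc₂ ⟨v, hv⟩
  exact ⟨H.isProperMap_proj, K.isGraphWithEnds H hcrit, K.isIsomorphicToGraph_iff H hcrit⟩
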